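/- Let $A=\{a,b\}$ and, for an integer $d\ge 0$, let $A_d^*$ be the set of words over $A$ that do not contain $d+1$ consecutive $b$'s, partially ordered by the (not necessarily contiguous) subword order $u\le w$. Let $\zeta$ and $\mu$ be the zeta function and the Möbius function of the poset $A_d^*$. Consider formal series $\sum_{(u,w)\in A^*\times A^*}c_{u,w}\,u\otimes w$ with $c_{u,w}\in\mathbb Z$, added coefficientwise and multiplied by $(u\otimes w)(u'\otimes w')=uu'\otimes ww'$. For a series $f$ without constant term let $f^*=\sum_{n\ge 0}f^n$. A series is rational if it can be obtained from finitely many monomials $c\,u\otimes w$ by finitely many sums, products and applications of $f\mapsto f^*$ to series without constant term. An embedding of $u=u_1\cdots u_k$ in $w=w_1\cdots w_n$ is a set $\iota=\{i_1<\dots<i_k\}$ with $u_j=w_{i_j}$ for all $j$. It is right-most if $i'_j\le i_j$ for every $j$ and every embedding $\{i'_1<\dots<i'_k\}$ of $u$ in $w$. It is $d$-normal if (a) $m\in\iota$ whenever $m\geq 2$ and $w_m=w_{m-1}$; and, if $d\geq 1$, (b) whenever $j>1$ and $u_j=\dots=u_{j+d-1}=b$, one has $w_{i_j-1}=a$ and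 $i_j-1\in\iota$; and (c) if $u$ begins with $b^d$, then none of $w_1,\dots,w_{i_1-1}$ is $b$. A finite-state automaton is a finite digraph (loops and multiple arcs allowed) with an initial vertex $\alpha$ and a final vertex $\omega\ne\alpha$, whose arcs are labelled by monomials $c\,u\otimes w$. The label of a walk is the product of the labels of its arcs. The automaton accepts the series $f$ if, for every $(u,w)$, only finitely many walks from $\alpha$ to $\omega$ have as label a multiple of $u\otimes w$, and their coefficients add up to the coefficient of $u\otimes w$ in $f$. **Theorem.** For every $d\ge 0$, the series $$Z_\otimes^d=\sum_{u,w\in A_d^*}\zeta(u,w)\,u\otimes w\qquad\text{and}\qquad M_\otimes^d=\sum_{u,w\in A_d^*}\mu(u,w)\,u\otimes w$$ are rational. Moreover: 1. there is a finite-state automaton accepting $Z_\otimes^d$ in which every walk from $\alpha$ to $\omega$ is labelled $u\otimes w$ (coefficient $1$) for some $u,w\in A_d^*$, and for all $u,w\in A_d^*$ the walks from $\alpha$ to $\omega$ labelled $u\otimes w$ are in bijection with the right-most embeddings of $u$ in $w$; 2. there is a finite-state automaton accepting $M_\otimes^d$ in which every walk from $\alpha$ to $\omega$ is labelled $(-1)^{|u|+|w|}u\otimes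 w$ for some $u,w\in A_d^*$, and for all $u,w\in A_d^*$ the walks from $\alpha$ to $\omega$ with that label are in bijection with the $d$-normal embeddings of $u$ in $w$. -/

import Mathlib

namespace WordPoset

/-- The alphabet `A = {a, b}`. -/
inductive Letter where
  | a
  | b
  deriving DecidableEq

/-- `A*_d`: the words over `{a, b}` that do not contain `d + 1` consecutive `b`'s. -/
def InAd (d : ℕ) (w : List Letter) : Prop :=
  ¬ List.replicate (d + 1) Letter.b <:+: w

instance (d : ℕ) : DecidablePred (InAd d) := fun w =>
  inferInstanceAs (Decidable (¬ List.replicate (d + 1) Letter.b <:+: w))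

/-- The underlying type of the poset `A*_d`. -/
@[ext]
structure Word (d : ℕ) where
  letters : List Letter
  mem : InAd d letters
  deriving DecidableEq

/-- The subword order. -/
instance (d : ℕ) : PartialOrder (Word d) where
  le u w := u.letters.Sublist w.letters
  le_refl u := List.Sublist.refl _
  le_trans _ _ _ h₁ h₂ := List.Sublist.trans h₁ h₂
  le_antisymm _ _ h₁ h₂ := Word.ext (List.Sublist.antisymm h₁ h₂)

instance (d : ℕ) : DecidableLE (Word d) := fun u w =>
  inferInstanceAs (Decidable (u.letters.Sublist w.letters))

theorem finite_Icc {d : ℕ} (u w : Word d) : (Set.Icc u w).Finite := by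
  refine Set.Finite.of_finite_image (f := Word.letters) ?_ (fun _ _ _ _ h => Word.ext h)
  refine (List.finite_toSet w.letters.sublists).subset ?_
  rintro _ ⟨v, hv, rfl⟩
  exact List.mem_sublists.2 hv.2

noncomputable instance (d : ℕ) : LocallyFiniteOrder (Word d) :=
  LocallyFiniteOrder.ofFiniteIcc finite_Icc

/-! ### Two-variable formal series -/

/-- Formal series `∑ c(u,w) u ⊗ w` with integer coefficients, `(u, w) ∈ A* × A*`. -/
def Series : Type := List Letter → List Letter → ℤ

namespace Series

/-- The monomial `c · u ⊗ w`. -/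
def monomial (c : ℤ) (u w : List Letter) : Series :=
  fun u' w' => if u' = u ∧ w' = w then c else 0

instance : One Series := ⟨monomial 1 [] []⟩

instance : Add Series := ⟨fun f g u w => f u w + g u w⟩

/-- The product determined by `(u ⊗ w)(u' ⊗ w') = uu' ⊗ ww'`: the coefficient at `u ⊗ w` is the sum
over all factorizations of `u` and of `w` into a prefix and a suffix. -/
instance : Mul Series :=
  ⟨fun f g u w => ∑ i ∈ Finset.range (u.length + 1), ∑ j ∈ Finset.range (w.length + 1),
    f (u.take i) (w.take j) * g (u.drop i) (w.drop j)⟩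

/-- The powers of a series. -/
def power (f : Series) : ℕ → Series
  | 0 => 1
  | n + 1 => f * power f n

theorem power_eq_zero (f : Series) (hf : f [] [] = 0) (n : ℕ) (u w : List Letter)
    (h : u.length + w.length < n) : f.power n u w = 0 := by
  induction n generalizing u w with
  | zero => omega
  | succ n ih =>
    change ∑ i ∈ Finset.range (u.length + 1), ∑ j ∈ Finset.range (w.length + 1),
      f (u.take i) (w.take j) * f.power n (u.drop i) (w.drop j) = 0
    refine Finset.sum_eq_zero fun i hi => Finset.sum_eq_zero fun j hj => ?_
    rw [Finset.mem_range] at hi hj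
    by_cases h0 : i = 0 ∧ j = 0
    · rw [h0.1, h0.2, List.take_zero, List.take_zero, hf, zero_mul]
    · rw [ih _ _ (by simp only [List.length_drop]; omega), mul_zero]

/-- `f* = 1 + f + f² + ⋯` for a series without constant term; by `power_eq_zero` only the powers
up to `|u| + |w|` contribute to the coefficient at `u ⊗ w`. -/
def star (f : Series) : Series :=
  fun u w => ∑ n ∈ Finset.range (u.length + w.length + 1), f.power n u w

/-- Rational series: those obtained from monomials by finitely many sums, products and stars (of
series without constant term). Negation and scalar multiplication are products with a monomial
`c · ε ⊗ ε`. -/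
inductive IsRational : Series → Prop
  | monomial (c : ℤ) (u w : List Letter) : IsRational (Series.monomial c u w)
  | add {f g : Series} : IsRational f → IsRational g → IsRational (f + g)
  | mul {f g : Series} : IsRational f → IsRational g → IsRational (f * g)
  | star {f : Series} : IsRational f → f [] [] = 0 → IsRational f.star

end Series

/-- The series `∑ f(u,w) u ⊗ w` over `u, w ∈ A*_d`. -/
def seriesOf (d : ℕ) (f : Word d → Word d → ℤ) : Series :=
  fun u w => if h : InAd d u ∧ InAd d w then f ⟨u, h.1⟩ ⟨w, h.2⟩ else 0

/-- `∑ ζ(u,w) u ⊗ w`, with `ζ` the zeta function of the poset `A*_d`. -/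
def zetaSeries (d : ℕ) : Series :=
  seriesOf d fun u w => IncidenceAlgebra.zeta ℤ u w

/-- `∑ μ(u,w) u ⊗ w`, with `μ` the Möbius function of the poset `A*_d`. -/
noncomputable def muSeries (d : ℕ) : Series :=
  seriesOf d fun u w => IncidenceAlgebra.mu ℤ u w

/-! ### Finite-state automata with `⊗`-labelled arcs -/

/-- A finite digraph (loops and multiple arcs allowed) with an initial and a final vertex, each arc
`e` being labelled by a monomial `coeff e · left e ⊗ right e`. -/
structure Automaton where
  V : Type
  E : Type
  finite_V : Finite V
  finite_E : Finite E
  src : E → V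
  tgt : E → V
  initial : V
  final : V
  initial_ne_final : initial ≠ final
  coeff : E → ℤ
  left : E → List Letter
  right : E → List Letter

namespace Automaton

/-- `D.IsWalk x p y`: the sequence of arcs `p` is a walk from `x` to `y`. -/
def IsWalk (D : Automaton) (x : D.V) : List D.E → D.V → Prop
  | [], y => x = y
  | e :: p, y => D.src e = x ∧ D.IsWalk (D.tgt e) p y

/-- The walks from the initial to the final vertex. -/
def Walk (D : Automaton) : Type := {p : List D.E // D.IsWalk D.initial p D.final}

/-- The label of a walk is the product of the labels of its arcs; this is its coefficient. -/
def walkCoeff (D : Automaton) (W : D.Walk) : ℤ := (W.1.map D.coeff).prod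

/-- The left word in the label of a walk. -/
def walkLeft (D : Automaton) (W : D.Walk) : List Letter := (W.1.map D.left).flatten

/-- The right word in the label of a walk. -/
def walkRight (D : Automaton) (W : D.Walk) : List Letter := (W.1.map D.right).flatten

/-- The walks from the initial to the final vertex labelled by a multiple of `u ⊗ w`. -/
def WalkOn (D : Automaton) (u w : List Letter) : Type :=
  {W : D.Walk // D.walkLeft W = u ∧ D.walkRight W = w}

/-- `D` accepts `f`: the sum of the labels of all walks from the initial to the final vertex is
well defined and equals `f`. -/
def Accepts (D : Automaton) (f : Series) : Prop :=
  ∀ u w : List Letter, Finite (D.WalkOn u w) ∧ ∑ᶠ W : D.WalkOn u w, D.walkCoeff W.1 = f u w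

end Automaton

/-! ### Embeddings -/

/-- An embedding of `u` in `w`: positions `i₁ < ⋯ < i_k` in `w` with `u_j = w_{i_j}`. -/
def Embedding (u w : List Letter) : Type :=
  {i : Fin u.length ↪o Fin w.length // ∀ j, u.get j = w.get (i j)}

/-- The right-most embedding dominates every embedding position by position. -/
def Embedding.IsRightmost {u w : List Letter} (i : Embedding u w) : Prop :=
  ∀ i' : Embedding u w, ∀ j, i'.1 j ≤ i.1 j

/-- `d`-normal embeddings. `repetition`: every position of `w` carrying the same letter as the
preceding position is in the embedding. `inner_run`: if a run of `d` `b`'s starts in `u` at a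
position `j` that is not the first, the letter of `w` just before the image of `j` is an `a` and is
in the embedding. `initial_run`: if `u` starts with a run of `d` `b`'s, no `b` occurs in `w` before
the image of the first letter of `u`. A run is nonempty, so for `d = 0` the last two are void. -/
structure Embedding.IsNormal (d : ℕ) {u w : List Letter} (i : Embedding u w) : Prop where
  repetition : ∀ p q : Fin w.length, q.val = p.val + 1 → w.get q = w.get p → q ∈ Set.range i.1
  inner_run : 0 < d → ∀ j : Fin u.length, 0 < j.val →
    List.replicate d Letter.b <+: u.drop j.val →
      ∃ p : Fin w.length, p.val + 1 = (i.1 j).val ∧ w.get p = Letter.a ∧ p ∈ Set.range i.1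
  initial_run : 0 < d → ∀ j : Fin u.length, j.val = 0 →
    List.replicate d Letter.b <+: u →
      ∀ p : Fin w.length, p < i.1 j → w.get p ≠ Letter.b

end WordPoset

/-! An embedding of `u` in `w` is a marking of some letters of `w`, hence a word over the finite
alphabet `Letter × Bool`. For a regular language `L` of marked words and `c = ±1`, let each `p ∈ L`
contribute `c ^ (|u| + |w|) u ⊗ w`. A deterministic automaton for `L`, given one final vertex,
accepts this series, with one walk per marking (`exists_automaton`). Its states also give a linear
system whose coefficients have no constant term, so that elimination with Arden's rule yields
rationality (`isRational_countSeries`). Restricting to words of `A*_d` preserves regularity. It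
remains to write `ζ` and `μ` as such counts.

For `ζ`, a marking is right-most when no unmarked letter equals the last marked letter before it.
There is exactly one such marking if `u ≤ w` and none otherwise, and the same holds for right-most
embeddings.

For `μ`, let `f(u,w)` be the number of normal markings with sign `(-1) ^ (|u| + |w|)`. The claim is
`f * ζ = 1`, that is, the sum of `f(u,v)` over distinct subwords `v` of `w` is `1` if `u = w` and
`0` otherwise. This is proved for all states of the normality automaton at once, by induction on
`|w|` (`normalSubwordSum_eq`). Subwords starting with `x` are `x` times the subwords of what follows
the first `x` in `w`, and this `x` is either marked or not. From the initial state, `v = ε` and the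
marked choices add up to the indicator of "`u` is a suffix of `w`"; the unmarked ones subtract the
indicators for `au` and `bu`. What is left is the indicator of `u = w`. Finally
`Embedding.isNormal_iff` identifies normal markings with `d`-normal embeddings. -/

namespace WordPoset

/-! ### The semiring of series and linear systems over it -/

namespace Series

@[ext]
theorem ext {f g : Series} (h : ∀ u w, f u w = g u w) : f = g :=
  funext fun u => funext fun w => h u w

instance : Zero Series := ⟨fun _ _ => 0⟩

theorem zero_apply (u w : List Letter) : (0 : Series) u w = 0 := rfl

theorem add_apply (f g : Series) (u w : List Letter) : (f + g) u w = f u w + g u w := rfl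

theorem mul_apply (f g : Series) (u w : List Letter) :
    (f * g) u w = ∑ i ∈ Finset.range (u.length + 1), ∑ j ∈ Finset.range (w.length + 1),
      f (u.take i) (w.take j) * g (u.drop i) (w.drop j) := rfl

theorem monomial_apply (c : ℤ) (u₀ w₀ u w : List Letter) :
    monomial c u₀ w₀ u w = if u = u₀ ∧ w = w₀ then c else 0 := rfl

theorem one_apply (u w : List Letter) :
    (1 : Series) u w = if u = [] ∧ w = [] then 1 else 0 := rfl

theorem monomial_mul_apply (c : ℤ) (u₀ w₀ u w : List Letter) (f : Series) :
    (monomial c u₀ w₀ * f) (u₀ ++ u) (w₀ ++ w) = c * f u w := by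
  rw [mul_apply, Finset.sum_eq_single u₀.length, Finset.sum_eq_single w₀.length]
  · simp [monomial_apply]
  · intro j hj hne
    rw [Finset.mem_range] at hj
    rw [monomial_apply, if_neg, zero_mul]
    rintro ⟨-, h⟩
    have := congrArg List.length h
    rw [List.length_take] at this
    omega
  · intro h
    simp at h
  · intro i hi hne
    rw [Finset.mem_range] at hi
    refine Finset.sum_eq_zero fun j _ => ?_
    rw [monomial_apply, if_neg, zero_mul]
    rintro ⟨h, -⟩
    have := congrArg List.length h
    rw [List.length_take] at this
    omega
  · intro h
    simp at h

theorem monomial_mul_apply_of_not_prefix (c : ℤ) (u₀ w₀ u w : List Letter) (f : Series)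
    (h : ¬ (u₀ <+: u ∧ w₀ <+: w)) : (monomial c u₀ w₀ * f) u w = 0 := by
  rw [mul_apply]
  refine Finset.sum_eq_zero fun i _ => Finset.sum_eq_zero fun j _ => ?_
  rw [monomial_apply, if_neg, zero_mul]
  rintro ⟨rfl, rfl⟩
  exact h ⟨List.take_prefix _ _, List.take_prefix _ _⟩

/-- Both sides run over the pairs `(k, m)` with `k + m ≤ n`. Associativity uses this once for each
tensor coordinate. -/
theorem sum_range_triangle {M : Type*} [AddCommMonoid M] (n : ℕ) (F : ℕ → ℕ → M) :
    ∑ i ∈ Finset.range (n + 1), ∑ k ∈ Finset.range (i + 1), F k (i - k) =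
      ∑ k ∈ Finset.range (n + 1), ∑ m ∈ Finset.range (n - k + 1), F k m := by
  rw [Finset.sum_sigma', Finset.sum_sigma']
  refine Finset.sum_nbij' (fun x => ⟨x.2, x.1 - x.2⟩) (fun x => ⟨x.1 + x.2, x.1⟩) ?_ ?_ ?_ ?_ ?_
  all_goals
    rintro ⟨i, k⟩ h
    simp only [Finset.mem_sigma, Finset.mem_range] at h ⊢
  · omega
  · omega
  · congr 1
    omega
  · congr 1
    omega

protected theorem mul_assoc (f g h : Series) : f * g * h = f * (g * h) := by
  ext u w
  -- The contribution of cutting `u` into pieces of lengths `k`, `m` and the rest, and `w` into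
  -- pieces of lengths `l`, `n` and the rest.
  let F : ℕ → ℕ → ℕ → ℕ → ℤ := fun k m l n =>
    f (u.take k) (w.take l) * g ((u.drop k).take m) ((w.drop l).take n) *
      h (u.drop (k + m)) (w.drop (l + n))
  have hl : (f * g * h) u w = ∑ i ∈ Finset.range (u.length + 1), ∑ k ∈ Finset.range (i + 1),
      ∑ j ∈ Finset.range (w.length + 1), ∑ l ∈ Finset.range (j + 1), F k (i - k) l (j - l) := by
    rw [mul_apply]
    refine Finset.sum_congr rfl fun i hi => ?_
    rw [Finset.sum_comm]
    refine Finset.sum_congr rfl fun j hj => ?_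
    rw [Finset.mem_range] at hi hj
    rw [mul_apply, Finset.sum_mul, List.length_take, List.length_take,
      min_eq_left (by omega), min_eq_left (by omega)]
    refine Finset.sum_congr rfl fun k hk => ?_
    rw [Finset.sum_mul]
    refine Finset.sum_congr rfl fun l hl => ?_
    rw [Finset.mem_range] at hk hl
    simp only [F, List.take_take, List.drop_take]
    rw [min_eq_left (by omega), min_eq_left (by omega), show k + (i - k) = i by omega,
      show l + (j - l) = j by omega]
  have hr : (f * (g * h)) u w = ∑ k ∈ Finset.range (u.length + 1),
      ∑ m ∈ Finset.range (u.length - k + 1),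
      ∑ l ∈ Finset.range (w.length + 1), ∑ n ∈ Finset.range (w.length - l + 1), F k m l n := by
    rw [mul_apply]
    refine Finset.sum_congr rfl fun k _ => ?_
    rw [Finset.sum_comm]
    refine Finset.sum_congr rfl fun l _ => ?_
    rw [mul_apply, Finset.mul_sum, List.length_drop, List.length_drop]
    refine Finset.sum_congr rfl fun m _ => ?_
    rw [Finset.mul_sum]
    refine Finset.sum_congr rfl fun n _ => ?_
    simp only [F, List.drop_drop]
    rw [mul_assoc]
  rw [hl, hr, sum_range_triangle u.length fun k m =>
    ∑ j ∈ Finset.range (w.length + 1), ∑ l ∈ Finset.range (j + 1), F k m l (j - l)]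
  exact Finset.sum_congr rfl fun k _ => Finset.sum_congr rfl fun m _ =>
    sum_range_triangle w.length fun l n => F k m l n

protected theorem mul_one (f : Series) : f * 1 = f := by
  ext u w
  rw [mul_apply, Finset.sum_eq_single u.length, Finset.sum_eq_single w.length]
  · simp [one_apply]
  · intro j hj hne
    rw [Finset.mem_range] at hj
    rw [one_apply, if_neg, mul_zero]
    rw [List.drop_eq_nil_iff (l := w)]
    omega
  · simp
  · intro i hi hne
    rw [Finset.mem_range] at hi
    refine Finset.sum_eq_zero fun j _ => ?_
    rw [one_apply, if_neg, mul_zero]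
    rw [List.drop_eq_nil_iff (l := u)]
    omega
  · simp

instance : Semiring Series where
  add_assoc f g h := by ext; simp only [add_apply]; ring
  zero_add f := by ext; simp only [add_apply, zero_apply]; ring
  add_zero f := by ext; simp only [add_apply, zero_apply]; ring
  add_comm f g := by ext; simp only [add_apply]; ring
  nsmul := nsmulRec
  left_distrib f g h := by
    ext; simp only [add_apply, mul_apply, mul_add, Finset.sum_add_distrib]
  right_distrib f g h := by
    ext; simp only [add_apply, mul_apply, add_mul, Finset.sum_add_distrib]
  zero_mul f := by ext; simp [mul_apply, zero_apply]
  mul_zero f := by ext; simp [mul_apply, zero_apply]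
  mul_assoc := Series.mul_assoc
  one_mul f := by
    ext u w
    exact (monomial_mul_apply 1 [] [] u w f).trans (one_mul _)
  mul_one := Series.mul_one

theorem sum_apply {ι : Type*} (s : Finset ι) (f : ι → Series) (u w : List Letter) :
    (∑ i ∈ s, f i) u w = ∑ i ∈ s, f i u w := by
  induction s using Finset.cons_induction with
  | empty => rfl
  | cons i s hi ih => rw [Finset.sum_cons, Finset.sum_cons, add_apply, ih]

theorem star_apply {f : Series} (hf : f [] [] = 0) {n : ℕ} (u w : List Letter)
    (h : u.length + w.length < n) : f.star u w = ∑ k ∈ Finset.range n, f.power k u w := by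
  refine Finset.sum_subset (Finset.range_mono h) fun k _ hk => ?_
  rw [Finset.mem_range] at hk
  exact power_eq_zero f hf k u w (by omega)

theorem star_eq {f : Series} (hf : f [] [] = 0) : f.star = 1 + f * f.star := by
  ext u w
  -- The sum is truncated one term later than necessary, so that enough powers remain once the
  -- zeroth is split off.
  rw [star_apply hf u w (Nat.lt_succ_of_lt (Nat.lt_succ_self _)), Finset.sum_range_succ', add_comm,
    add_apply, mul_apply]
  congr 1
  have : ∀ k, f.power (k + 1) u w = ∑ i ∈ Finset.range (u.length + 1),
      ∑ j ∈ Finset.range (w.length + 1),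
        f (u.take i) (w.take j) * f.power k (u.drop i) (w.drop j) := fun k => rfl
  simp_rw [this]
  rw [Finset.sum_comm]
  refine Finset.sum_congr rfl fun i _ => ?_
  rw [Finset.sum_comm]
  refine Finset.sum_congr rfl fun j _ => ?_
  rw [← Finset.mul_sum, star_apply hf]
  simp only [List.length_drop]
  omega

/-- Arden's rule. -/
theorem eq_star_mul {a c x : Series} (ha : a [] [] = 0) (hx : x = a * x + c) :
    x = a.star * c := by
  have hy : a.star * c = a * (a.star * c) + c := by
    conv_lhs => rw [star_eq ha]
    rw [add_mul, one_mul, mul_assoc, add_comm]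
  generalize a.star * c = y at hy
  -- The equation has only one solution: in the product, the value of the unknown at `(u, w)` itself
  -- is multiplied by the constant term of `a`, which is zero, so induction on total length applies.
  have key : ∀ n, ∀ u w : List Letter, u.length + w.length < n → x u w = y u w := by
    intro n
    induction n with
    | zero => intro u w h; omega
    | succ n ih =>
      intro u w h
      rw [hx, hy, add_apply, add_apply, mul_apply, mul_apply]
      congr 1
      refine Finset.sum_congr rfl fun i hi => Finset.sum_congr rfl fun j hj => ?_
      rw [Finset.mem_range] at hi hj
      by_cases h0 : i = 0 ∧ j = 0
      · rw [h0.1, h0.2, List.take_zero, List.take_zero, ha, zero_mul, zero_mul]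
      · rw [ih _ _ (by simp only [List.length_drop]; omega)]
  ext u w
  exact key _ u w (Nat.lt_succ_self _)

theorem IsRational.zero : IsRational 0 := by
  have : (0 : Series) = Series.monomial 0 [] [] := by ext; simp [monomial_apply, zero_apply]
  rw [this]
  exact .monomial _ _ _

theorem IsRational.sum {ι : Type*} (s : Finset ι) {f : ι → Series}
    (h : ∀ i ∈ s, IsRational (f i)) : IsRational (∑ i ∈ s, f i) := by
  induction s using Finset.cons_induction with
  | empty => exact .zero
  | cons i s hi ih =>
    rw [Finset.sum_cons]
    exact .add (h i (Finset.mem_cons_self _ _)) (ih fun j hj => h j (Finset.mem_cons_of_mem hj))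

theorem mul_apply_nil (f g : Series) : (f * g) [] [] = f [] [] * g [] [] := by
  simp [mul_apply]

/-- The solution of a finite linear system whose coefficients are rational and have no constant
term is rational. -/
theorem IsRational.of_linear_system {n : ℕ} {a : Fin n → Fin n → Series} {c x : Fin n → Series}
    (ha : ∀ i j, IsRational (a i j)) (ha₀ : ∀ i j, a i j [] [] = 0) (hc : ∀ i, IsRational (c i))
    (hx : ∀ i, x i = ∑ j, a i j * x j + c i) (i : Fin n) : IsRational (x i) := by
  induction n with
  | zero => exact i.elim0
  | succ n ih =>
    -- Gaussian elimination: Arden's rule solves the first equation for `x 0`, and substitution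
    -- leaves a system in the other unknowns.
    have h0 : x 0 = (a 0 0).star * (∑ j : Fin n, a 0 j.succ * x j.succ + c 0) := by
      refine eq_star_mul (ha₀ 0 0) ?_
      conv_lhs => rw [hx 0]
      rw [Fin.sum_univ_succ, add_assoc]
    have hs : IsRational (a 0 0).star := .star (ha 0 0) (ha₀ 0 0)
    have hsucc : ∀ i : Fin n, IsRational (x i.succ) := by
      refine ih (a := fun i j => a i.succ j.succ + a i.succ 0 * ((a 0 0).star * a 0 j.succ))
        (c := fun i => c i.succ + a i.succ 0 * ((a 0 0).star * c 0))
        (x := fun i => x i.succ) ?_ ?_ ?_ ?_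
      · exact fun i j => .add (ha _ _) (.mul (ha _ _) (.mul hs (ha _ _)))
      · intro i j
        rw [add_apply, mul_apply_nil, ha₀, ha₀, zero_mul, zero_add]
      · exact fun i => .add (hc _) (.mul (ha _ _) (.mul hs (hc _)))
      · intro i
        conv_lhs => rw [hx i.succ, Fin.sum_univ_succ, h0]
        simp only [add_mul, Finset.sum_add_distrib, mul_add, Finset.mul_sum, mul_assoc]
        abel
    refine Fin.cases ?_ hsucc i
    rw [h0]
    exact .mul hs (.add (.sum _ fun j _ => .mul (ha _ _) (hsucc j)) (hc 0))

end Series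

end WordPoset

namespace WordPoset

instance : Fintype Letter := ⟨{Letter.a, Letter.b}, fun x => by cases x <;> simp⟩

/-! ### Marked words -/

/-- The word underlying a marked word. -/
def underlying (p : List (Letter × Bool)) : List Letter := p.map Prod.fst

/-- The subword formed by the marked letters. -/
def selected : List (Letter × Bool) → List Letter
  | [] => []
  | (x, true) :: p => x :: selected p
  | (_, false) :: p => selected p

@[simp] theorem underlying_nil : underlying [] = [] := rfl

@[simp] theorem underlying_cons (e : Letter × Bool) (p : List (Letter × Bool)) :
    underlying (e :: p) = e.1 :: underlying p := rfl

@[simp] theorem selected_nil : selected [] = [] := rfl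

@[simp] theorem selected_cons_true (x : Letter) (p : List (Letter × Bool)) :
    selected ((x, true) :: p) = x :: selected p := rfl

@[simp] theorem selected_cons_false (x : Letter) (p : List (Letter × Bool)) :
    selected ((x, false) :: p) = selected p := rfl

theorem underlying_append (p q : List (Letter × Bool)) :
    underlying (p ++ q) = underlying p ++ underlying q := List.map_append

theorem selected_append (p q : List (Letter × Bool)) :
    selected (p ++ q) = selected p ++ selected q := by
  induction p with
  | nil => rfl
  | cons e p ih => obtain ⟨x, _ | _⟩ := e <;> simp [ih]

theorem selected_sublist (p : List (Letter × Bool)) : (selected p).Sublist (underlying p) := by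
  induction p with
  | nil => simp
  | cons e p ih =>
    obtain ⟨x, _ | _⟩ := e
    · exact ih.cons x
    · exact ih.cons_cons x

/-- The members of `L` that mark the subword `u` of the word `w`. -/
def markings (L : Language (Letter × Bool)) (u w : List Letter) : Set (List (Letter × Bool)) :=
  {p | p ∈ L ∧ selected p = u ∧ underlying p = w}

/-- The language of all `p` such that `e :: p` belongs to `L`. -/
def consQuotient (L : Language (Letter × Bool)) (e : Letter × Bool) : Language (Letter × Bool) :=
  {p | e :: p ∈ L}

theorem mem_consQuotient {L : Language (Letter × Bool)} {e : Letter × Bool}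
    {p : List (Letter × Bool)} : p ∈ consQuotient L e ↔ e :: p ∈ L := Iff.rfl

open Classical in
theorem markings_nil (L : Language (Letter × Bool)) (u : List Letter) :
    markings L u [] = if u = [] ∧ [] ∈ L then {[]} else ∅ := by
  ext p
  cases p with
  | nil => split_ifs with h <;> simp [markings] <;> tauto
  | cons e p => split_ifs <;> simp [markings]

theorem markings_cons_nil (L : Language (Letter × Bool)) (x : Letter) (w : List Letter) :
    markings L [] (x :: w) =
      List.cons (x, false) '' markings (consQuotient L (x, false)) [] w := by
  ext p
  rcases p with _ | ⟨⟨y, _ | _⟩, p⟩ <;> simp [markings, mem_consQuotient]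
  · constructor
    · rintro ⟨h₁, h₂, rfl, h₃⟩
      exact ⟨⟨h₁, h₂, h₃⟩, rfl⟩
    · rintro ⟨⟨h₁, h₂, h₃⟩, rfl⟩
      exact ⟨h₁, h₂, rfl, h₃⟩

theorem markings_cons_cons (L : Language (Letter × Bool)) (y x : Letter) (u w : List Letter) :
    markings L (y :: u) (x :: w) =
      List.cons (x, false) '' markings (consQuotient L (x, false)) (y :: u) w ∪
        if y = x then List.cons (x, true) '' markings (consQuotient L (x, true)) u w else ∅ := by
  ext p
  rcases p with _ | ⟨⟨z, _ | _⟩, p⟩ <;> split_ifs with h <;> simp [markings, mem_consQuotient]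
  all_goals grind

theorem finite_markings (L : Language (Letter × Bool)) (u w : List Letter) :
    (markings L u w).Finite := by
  induction w generalizing L u with
  | nil => rw [markings_nil]; split_ifs <;> simp
  | cons x w ih =>
    cases u with
    | nil => rw [markings_cons_nil]; exact (ih _ _).image _
    | cons y u =>
      rw [markings_cons_cons]
      refine ((ih _ _).image _).union ?_
      split_ifs
      · exact (ih _ _).image _
      · exact Set.finite_empty

/-! ### Counting series -/

/-- The series in which each `p ∈ L`, marking the subword `u` of `w`, contributes
`c ^ (|u| + |w|) u ⊗ w`. -/
noncomputable def countSeries (c : ℤ) (L : Language (Letter × Bool)) : Series :=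
  fun u w => c ^ (u.length + w.length) * (markings L u w).ncard

theorem countSeries_apply (c : ℤ) (L : Language (Letter × Bool)) (u w : List Letter) :
    countSeries c L u w = c ^ (u.length + w.length) * (markings L u w).ncard := rfl

open Classical in
theorem countSeries_nil (c : ℤ) (L : Language (Letter × Bool)) (u : List Letter) :
    countSeries c L u [] = if u = [] ∧ [] ∈ L then 1 else 0 := by
  rw [countSeries_apply, markings_nil]
  split_ifs with h
  · simp [h.1]
  · simp

theorem countSeries_cons_nil (c : ℤ) (L : Language (Letter × Bool)) (x : Letter)
    (w : List Letter) :
    countSeries c L [] (x :: w) = c * countSeries c (consQuotient L (x, false)) [] w := by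
  rw [countSeries_apply, countSeries_apply, markings_cons_nil,
    Set.ncard_image_of_injective _ List.cons_injective]
  simp only [List.length_nil, List.length_cons]
  ring

/-- A marked letter lengthens both words and costs `c * c = 1`; an unmarked one lengthens only `w`
and costs `c`. -/
theorem countSeries_cons_cons {c : ℤ} (hc : c * c = 1) (L : Language (Letter × Bool))
    (y x : Letter) (u w : List Letter) :
    countSeries c L (y :: u) (x :: w) =
      c * countSeries c (consQuotient L (x, false)) (y :: u) w +
        if y = x then countSeries c (consQuotient L (x, true)) u w else 0 := by
  simp only [countSeries_apply]
  rw [markings_cons_cons]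
  split_ifs with h
  · rw [Set.ncard_union_eq _ ((finite_markings _ _ _).image _) ((finite_markings _ _ _).image _),
      Set.ncard_image_of_injective _ List.cons_injective,
      Set.ncard_image_of_injective _ List.cons_injective]
    · simp only [List.length_cons]
      push_cast
      linear_combination
        c ^ (u.length + w.length) * ((markings (consQuotient L (x, true)) u w).ncard : ℤ) * hc
    · rw [Set.disjoint_left]
      rintro _ ⟨p, -, rfl⟩ ⟨q, -, h⟩
      simp at h
  · rw [Set.union_empty, Set.ncard_image_of_injective _ List.cons_injective]
    simp only [List.length_cons]
    ring

/-- The monomial contributed by a single letter of a marked word. -/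
def letterSeries (c : ℤ) : Letter × Bool → Series
  | (x, true) => Series.monomial 1 [x] [x]
  | (x, false) => Series.monomial c [] [x]

theorem letterSeries_isRational (c : ℤ) (e : Letter × Bool) : (letterSeries c e).IsRational := by
  obtain ⟨x, _ | _⟩ := e <;> exact .monomial _ _ _

theorem letterSeries_nil (c : ℤ) (e : Letter × Bool) : letterSeries c e [] [] = 0 := by
  obtain ⟨x, _ | _⟩ := e <;> simp [letterSeries, Series.monomial_apply]

-- A member of `L` is empty or consists of a first letter `e` and a member of the quotient by `e`.
-- For the languages accepted from the states of a deterministic automaton these equations form a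
-- closed linear system.
open Classical in
theorem countSeries_eq_sum {c : ℤ} (hc : c * c = 1) (L : Language (Letter × Bool)) :
    countSeries c L = ∑ e, letterSeries c e * countSeries c (consQuotient L e) +
      if [] ∈ L then 1 else 0 := by
  have hone : ∀ u w, (if [] ∈ L then 1 else 0 : Series) u w =
      if u = [] ∧ w = [] ∧ [] ∈ L then 1 else 0 := by
    intro u w
    split_ifs <;> simp_all [Series.one_apply, Series.zero_apply]
  have hfalse : ∀ (x y : Letter) (u w : List Letter) (f : Series),
      (Series.monomial c [] [y] * f) u (x :: w) = if y = x then c * f u w else 0 := by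
    intro x y u w f
    split_ifs with h
    · subst h
      exact Series.monomial_mul_apply c [] [y] u w f
    · exact Series.monomial_mul_apply_of_not_prefix _ _ _ _ _ _ (by simp [h])
  have htrue : ∀ (x y z : Letter) (u w : List Letter) (f : Series),
      (Series.monomial 1 [y] [y] * f) (z :: u) (x :: w) = if y = z ∧ y = x then f u w else 0 := by
    intro x y z u w f
    split_ifs with h
    · obtain ⟨rfl, rfl⟩ := h
      exact (Series.monomial_mul_apply 1 [y] [y] u w f).trans (one_mul _)
    · exact Series.monomial_mul_apply_of_not_prefix _ _ _ _ _ _ (by simpa using h)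
  have hnil : ∀ (x y : Letter) (w : List Letter) (f : Series),
      (Series.monomial 1 [y] [y] * f) [] (x :: w) = 0 := fun x y w f =>
    Series.monomial_mul_apply_of_not_prefix _ _ _ _ _ _ (by simp)
  ext u w
  rw [Series.add_apply, hone, Series.sum_apply, Fintype.sum_prod_type]
  cases w with
  | nil =>
    rw [countSeries_nil, Finset.sum_eq_zero, zero_add]
    · simp
    · refine fun x _ => Finset.sum_eq_zero fun m _ => ?_
      cases m <;> exact Series.monomial_mul_apply_of_not_prefix _ _ _ _ _ _ (by simp)
  | cons x w =>
    cases u with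
    | nil =>
      rw [countSeries_cons_nil]
      simp [letterSeries, hfalse, hnil]
    | cons y u =>
      rw [countSeries_cons_cons hc]
      simp only [letterSeries, Fintype.sum_bool, hfalse, htrue]
      rw [Finset.sum_eq_single x]
      · by_cases h : y = x
        · subst h
          simp [add_comm]
        · simp [h, Ne.symm h]
      · intro z _ hz
        simp [hz]
      · simp

/-! ### Regular languages of marked words -/

theorem isRational_countSeries {c : ℤ} (hc : c * c = 1) {L : Language (Letter × Bool)}
    (hL : L.IsRegular) : (countSeries c L).IsRational := by
  classical
  obtain ⟨σ, _, M, rfl⟩ := Language.isRegular_iff.{0, 0}.1 hL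
  have hq : ∀ s e, consQuotient (M.acceptsFrom s) e = M.acceptsFrom (M.step s e) := fun s e => by
    ext p
    rfl
  have hsys : ∀ s, countSeries c (M.acceptsFrom s) =
      ∑ t, (∑ e, if M.step s e = t then letterSeries c e else 0) *
        countSeries c (M.acceptsFrom t) + if [] ∈ M.acceptsFrom s then 1 else 0 := by
    intro s
    conv_lhs => rw [countSeries_eq_sum hc]
    congr 1
    simp only [Finset.sum_mul]
    rw [Finset.sum_comm]
    refine Finset.sum_congr rfl fun e _ => ?_
    simp [hq, ite_mul]
  let φ := Fintype.equivFin σ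
  have := Series.IsRational.of_linear_system
    (a := fun i j => ∑ e, if M.step (φ.symm i) e = φ.symm j then letterSeries c e else 0)
    (c := fun i => if [] ∈ M.acceptsFrom (φ.symm i) then 1 else 0)
    (x := fun i => countSeries c (M.acceptsFrom (φ.symm i))) ?_ ?_ ?_ ?_ (φ M.start)
  · rw [φ.symm_apply_apply] at this
    exact this
  · intro i j
    refine .sum _ fun e _ => ?_
    split_ifs
    · exact letterSeries_isRational _ _
    · exact .zero
  · intro i j
    rw [Series.sum_apply]
    refine Finset.sum_eq_zero fun e _ => ?_
    split_ifs
    · exact letterSeries_nil _ _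
    · rfl
  · intro i
    split_ifs
    · exact .monomial _ _ _
    · exact .zero
  · intro i
    rw [hsys, ← φ.symm.sum_comp]

/-- A language is regular if membership is determined by a function with finitely many values that
is compatible with adding a letter on the left. -/
theorem isRegular_of_finite {α T : Type*} [Finite T] {L : Language α} (φ : List α → T)
    (hφ : ∀ x p q, φ p = φ q → φ (x :: p) = φ (x :: q))
    (hL : ∀ p q, φ p = φ q → p ∈ L → q ∈ L) : L.IsRegular := by
  -- Since `φ` is compatible with adding letters on the left, its values are the states of an
  -- automaton reading words from right to left. A chosen preimage stands for each value.
  apply Language.IsRegular.of_reverse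
  refine Language.isRegular_iff.2 ⟨Set.range φ, Fintype.ofFinite _,
    ⟨fun t x => ⟨φ (x :: t.2.choose), Set.mem_range_self _⟩, ⟨φ [], Set.mem_range_self _⟩,
      {t | t.2.choose ∈ L}⟩, ?_⟩
  ext p
  rw [DFA.mem_accepts, Language.mem_reverse]
  have key : ∀ q : List α, DFA.eval ⟨fun t x => ⟨φ (x :: t.2.choose), Set.mem_range_self _⟩,
      ⟨φ [], Set.mem_range_self _⟩, {t : Set.range φ | t.2.choose ∈ L}⟩ q =
        ⟨φ q.reverse, Set.mem_range_self _⟩ := by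
    intro q
    induction q using List.reverseRecOn with
    | nil => rfl
    | append_singleton q x ih =>
      rw [DFA.eval_append_singleton, ih]
      simp only [List.reverse_append, List.reverse_cons, List.reverse_nil, List.nil_append,
        List.singleton_append, Subtype.mk.injEq]
      exact hφ _ _ _ (Set.mem_range_self (f := φ) q.reverse).choose_spec
  rw [key]
  have hs := (Set.mem_range_self (f := φ) p.reverse).choose_spec
  exact ⟨hL _ _ hs, hL _ _ hs.symm⟩

/-- The automaton that reads a marked word as a deterministic automaton does, and from each
accepting state has an arc labelled `ε ⊗ ε` to the final vertex. -/
def Automaton.ofDFA {σ : Type} [Finite σ] (M : DFA (Letter × Bool) σ) (c : ℤ) : Automaton where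
  V := Option σ
  E := σ × (Letter × Bool) ⊕ M.accept
  finite_V := inferInstance
  finite_E := inferInstance
  src := Sum.elim (fun e => some e.1) fun s => some s
  tgt := Sum.elim (fun e => some (M.step e.1 e.2)) fun _ => none
  initial := some M.start
  final := none
  initial_ne_final := Option.some_ne_none _
  coeff := Sum.elim (fun e => if e.2.2 then 1 else c) fun _ => 1
  left := Sum.elim (fun e => if e.2.2 then [e.2.1] else []) fun _ => []
  right := Sum.elim (fun e => [e.2.1]) fun _ => []

namespace Automaton

variable {σ : Type} [Finite σ] (M : DFA (Letter × Bool) σ) (c : ℤ)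

/-- The marked word read along a sequence of arcs. -/
def markedWord : List (ofDFA M c).E → List (Letter × Bool)
  | [] => []
  | Sum.inl e :: l => e.2 :: markedWord l
  | Sum.inr _ :: l => markedWord l

theorem flatten_map_left (l : List (ofDFA M c).E) :
    (l.map (ofDFA M c).left).flatten = selected (markedWord M c l) := by
  induction l with
  | nil => rfl
  | cons e l ih =>
    rw [List.map_cons, List.flatten_cons, ih]
    rcases e with ⟨s, x, _ | _⟩ | s <;> rfl

theorem flatten_map_right (l : List (ofDFA M c).E) :
    (l.map (ofDFA M c).right).flatten = underlying (markedWord M c l) := by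
  induction l with
  | nil => rfl
  | cons e l ih =>
    rw [List.map_cons, List.flatten_cons, ih]
    rcases e with ⟨s, x, _ | _⟩ | s <;> rfl

theorem prod_map_coeff (hc : c * c = 1) (l : List (ofDFA M c).E) :
    (l.map (ofDFA M c).coeff).prod =
      c ^ ((selected (markedWord M c l)).length + (underlying (markedWord M c l)).length) := by
  induction l with
  | nil => simp [markedWord]
  | cons e l ih =>
    rw [List.map_cons, List.prod_cons, ih]
    rcases e with ⟨s, x, _ | _⟩ | s
    · simp only [markedWord, selected_cons_false, underlying_cons, List.length_cons]
      change c * _ = _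
      ring
    · simp only [markedWord, selected_cons_true, underlying_cons, List.length_cons]
      change 1 * _ = _
      linear_combination -(c ^ ((selected (markedWord M c l)).length +
        (underlying (markedWord M c l)).length)) * hc
    · exact one_mul _

/-- No arc leaves the final vertex, so a walk uses exactly one closing arc, as its last. -/
theorem isWalk_none_nil (l : List (ofDFA M c).E) (h : (ofDFA M c).IsWalk none l none) :
    l = [] := by
  rcases l with _ | ⟨_ | _, l⟩
  · rfl
  · exact absurd h.1 (Option.some_ne_none _)
  · exact absurd h.1 (Option.some_ne_none _)

theorem markedWord_mem (l : List (ofDFA M c).E) (s : σ)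
    (h : (ofDFA M c).IsWalk (some s) l none) : markedWord M c l ∈ M.acceptsFrom s := by
  induction l generalizing s with
  | nil => exact absurd h (Option.some_ne_none _)
  | cons e l ih =>
    rcases e with ⟨t, e⟩ | t
    · obtain rfl : t = s := Option.some_injective _ h.1
      exact ih _ h.2
    · obtain rfl : t.1 = s := Option.some_injective _ h.1
      rw [isWalk_none_nil M c l h.2]
      exact t.2

/-- By determinism the starting state and the word read fix every arc, and the closing arc is fixed
by its source. -/
theorem markedWord_injOn (l l' : List (ofDFA M c).E) (s : σ)
    (h : (ofDFA M c).IsWalk (some s) l none) (h' : (ofDFA M c).IsWalk (some s) l' none)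
    (heq : markedWord M c l = markedWord M c l') : l = l' := by
  induction l generalizing l' s with
  | nil => exact absurd h (Option.some_ne_none _)
  | cons e l ih =>
    rcases l' with _ | ⟨e', l'⟩
    · exact absurd h' (Option.some_ne_none _)
    rcases e with ⟨t, e⟩ | t <;> rcases e' with ⟨t', e'⟩ | t'
    · obtain rfl : t = s := Option.some_injective _ h.1
      obtain rfl : t' = t := Option.some_injective _ h'.1
      obtain ⟨rfl, htail⟩ := List.cons_eq_cons.1 heq
      rw [ih _ _ h.2 h'.2 htail]
    · rw [isWalk_none_nil M c l' h'.2] at heq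
      exact absurd heq (List.cons_ne_nil _ _)
    · rw [isWalk_none_nil M c l h.2] at heq
      exact absurd heq.symm (List.cons_ne_nil _ _)
    · obtain rfl : t = t' := Subtype.ext (Option.some_injective _ (h.1.trans h'.1.symm))
      rw [isWalk_none_nil M c l h.2, isWalk_none_nil M c l' h'.2]

theorem exists_markedWord_eq (p : List (Letter × Bool)) (s : σ) (hp : p ∈ M.acceptsFrom s) :
    ∃ l, (ofDFA M c).IsWalk (some s) l none ∧ markedWord M c l = p := by
  induction p generalizing s with
  | nil => exact ⟨[Sum.inr ⟨s, hp⟩], ⟨rfl, rfl⟩, rfl⟩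
  | cons e p ih =>
    obtain ⟨l, hl, rfl⟩ := ih (M.step s e) hp
    exact ⟨Sum.inl (s, e) :: l, ⟨rfl, hl⟩, rfl⟩

theorem nonempty_walkOn_equiv (u w : List Letter) :
    Nonempty ((ofDFA M c).WalkOn u w ≃ markings M.accepts u w) := by
  refine ⟨Equiv.ofBijective (fun W => ⟨markedWord M c W.1.1, markedWord_mem M c _ _ W.1.2,
    (flatten_map_left M c _).symm.trans W.2.1, (flatten_map_right M c _).symm.trans W.2.2⟩)
    ⟨fun W W' h => ?_, fun p => ?_⟩⟩
  · exact Subtype.ext (Subtype.ext (markedWord_injOn M c _ _ _ W.1.2 W'.1.2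
      (congrArg Subtype.val h)))
  · obtain ⟨p, hp, hu, hw⟩ := p
    obtain ⟨l, hl, rfl⟩ := exists_markedWord_eq M c p M.start hp
    exact ⟨⟨⟨l, hl⟩, (flatten_map_left M c l).trans hu, (flatten_map_right M c l).trans hw⟩, rfl⟩

end Automaton

/-- A regular language of marked words is read by an automaton accepting its counting series. -/
theorem exists_automaton {c : ℤ} (hc : c * c = 1) {L : Language (Letter × Bool)}
    (hL : L.IsRegular) : ∃ D : Automaton, D.Accepts (countSeries c L) ∧
      (∀ W : D.Walk, (∃ p ∈ L, D.walkLeft W = selected p ∧ D.walkRight W = underlying p) ∧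
        D.walkCoeff W = c ^ ((D.walkLeft W).length + (D.walkRight W).length)) ∧
      ∀ u w, Nonempty (D.WalkOn u w ≃ markings L u w) := by
  obtain ⟨σ, _, M, rfl⟩ := Language.isRegular_iff.{0, 0}.1 hL
  have hcoeff : ∀ W : (Automaton.ofDFA M c).Walk, (Automaton.ofDFA M c).walkCoeff W =
      c ^ (((Automaton.ofDFA M c).walkLeft W).length +
        ((Automaton.ofDFA M c).walkRight W).length) := by
    intro W
    rw [Automaton.walkLeft, Automaton.walkRight, Automaton.flatten_map_left,
      Automaton.flatten_map_right]
    exact Automaton.prod_map_coeff M c hc W.1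
  refine ⟨Automaton.ofDFA M c, fun u w => ?_, fun W => ⟨⟨Automaton.markedWord M c W.1,
    Automaton.markedWord_mem M c _ _ W.2, Automaton.flatten_map_left M c _,
    Automaton.flatten_map_right M c _⟩, hcoeff W⟩, Automaton.nonempty_walkOn_equiv M c⟩
  obtain ⟨φ⟩ := Automaton.nonempty_walkOn_equiv M c u w
  have : Finite (markings M.accepts u w) := finite_markings _ u w
  have hfin : Finite ((Automaton.ofDFA M c).WalkOn u w) := Finite.of_equiv _ φ.symm
  refine ⟨hfin, ?_⟩
  have := Fintype.ofFinite ((Automaton.ofDFA M c).WalkOn u w)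
  rw [finsum_eq_sum_of_fintype, Finset.sum_congr rfl fun W _ => (hcoeff W.1).trans
    (by rw [W.2.1, W.2.2]), Finset.sum_const, countSeries_apply, Finset.card_univ,
    ← Nat.card_eq_fintype_card, Nat.card_congr φ, Nat.card_coe_set_eq, nsmul_eq_mul, mul_comm]

end WordPoset

namespace WordPoset

/-! ### Words without long runs of `b` -/

theorem InAd.of_infix {d : ℕ} {u w : List Letter} (hw : InAd d w) (h : u <:+: w) : InAd d u :=
  fun hu => hw (hu.trans h)

theorem InAd.tail {d : ℕ} {x : Letter} {u : List Letter} (h : InAd d (x :: u)) : InAd d u :=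
  h.of_infix (List.suffix_cons x u).isInfix

theorem inAd_cons {d : ℕ} {x : Letter} {u : List Letter} :
    InAd d (x :: u) ↔ ¬ List.replicate (d + 1) Letter.b <+: x :: u ∧ InAd d u := by
  rw [InAd, List.infix_cons_iff, not_or, InAd]

/-- The length of the initial run of `b`, up to `d + 1`, and membership in `A*_d`. -/
def runProfile (d : ℕ) (u : List Letter) : (Fin (d + 2) → Prop) × Prop :=
  (fun k => List.replicate k Letter.b <+: u, InAd d u)

theorem runProfile_prefix_iff {d : ℕ} {u v : List Letter} (h : runProfile d u = runProfile d v)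
    {k : ℕ} (hk : k < d + 2) :
    List.replicate k Letter.b <+: u ↔ List.replicate k Letter.b <+: v :=
  iff_of_eq (congrFun (congrArg Prod.fst h) ⟨k, hk⟩)

theorem replicate_prefix_cons_iff {d : ℕ} {u v : List Letter} (h : runProfile d u = runProfile d v)
    (x : Letter) {k : ℕ} (hk : k < d + 2) :
    List.replicate k Letter.b <+: x :: u ↔ List.replicate k Letter.b <+: x :: v := by
  cases k with
  | zero => simp
  | succ k =>
    rw [List.replicate_succ, List.cons_prefix_cons, List.cons_prefix_cons,
      runProfile_prefix_iff h (by omega)]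

theorem runProfile_cons {d : ℕ} {u v : List Letter} (h : runProfile d u = runProfile d v)
    (x : Letter) : runProfile d (x :: u) = runProfile d (x :: v) := by
  refine Prod.ext (funext fun k => propext (replicate_prefix_cons_iff h x k.2)) (propext ?_)
  change InAd d (x :: u) ↔ InAd d (x :: v)
  rw [inAd_cons, inAd_cons, replicate_prefix_cons_iff h x (Nat.lt_succ_self _)]
  exact and_congr_right fun _ => iff_of_eq (congrArg Prod.snd h)

theorem runProfile_selected_cons {d : ℕ} {p q : List (Letter × Bool)}
    (h : runProfile d (selected p) = runProfile d (selected q)) (e : Letter × Bool) :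
    runProfile d (selected (e :: p)) = runProfile d (selected (e :: q)) := by
  obtain ⟨x, _ | _⟩ := e
  · exact h
  · exact runProfile_cons h x

/-- The members of `L` that mark a word of `A*_d` in a word of `A*_d`. -/
def restrict (d : ℕ) (L : Language (Letter × Bool)) : Language (Letter × Bool) :=
  L ⊓ ({p | InAd d (selected p)} ⊓ {p | InAd d (underlying p)} : Set (List (Letter × Bool)))

theorem mem_restrict {d : ℕ} {L : Language (Letter × Bool)} {p : List (Letter × Bool)} :
    p ∈ restrict d L ↔ p ∈ L ∧ InAd d (selected p) ∧ InAd d (underlying p) := Iff.rfl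

theorem isRegular_restrict (d : ℕ) {L : Language (Letter × Bool)} (hL : L.IsRegular) :
    (restrict d L).IsRegular := by
  refine hL.inf (Language.IsRegular.inf ?_ ?_)
  · exact isRegular_of_finite (fun p => runProfile d (selected p))
      (fun e p q h => runProfile_selected_cons h e)
      (fun p q h => (iff_of_eq (congrArg Prod.snd h)).1)
  · exact isRegular_of_finite (fun p => runProfile d (underlying p))
      (fun e p q h => runProfile_cons h e.1)
      (fun p q h => (iff_of_eq (congrArg Prod.snd h)).1)

theorem markings_restrict {d : ℕ} (L : Language (Letter × Bool)) {u w : List Letter}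
    (hu : InAd d u) (hw : InAd d w) : markings (restrict d L) u w = markings L u w := by
  ext p
  constructor
  · rintro ⟨h, h'⟩
    exact ⟨(mem_restrict.1 h).1, h'⟩
  · rintro ⟨h, rfl, rfl⟩
    exact ⟨mem_restrict.2 ⟨h, hu, hw⟩, rfl, rfl⟩

theorem markings_restrict_eq_empty {d : ℕ} (L : Language (Letter × Bool)) {u w : List Letter}
    (h : ¬ (InAd d u ∧ InAd d w)) : markings (restrict d L) u w = ∅ := by
  refine Set.eq_empty_of_forall_notMem ?_
  rintro p ⟨hp, rfl, rfl⟩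
  exact h (mem_restrict.1 hp).2

/-- The language need only count correctly on `A*_d`; restricting it removes all other coefficients.
-/
theorem seriesOf_eq_countSeries {d : ℕ} {f : Word d → Word d → ℤ} {c : ℤ}
    {L : Language (Letter × Bool)} (h : ∀ u w, f u w = countSeries c L u.letters w.letters) :
    seriesOf d f = countSeries c (restrict d L) := by
  ext u w
  rw [seriesOf]
  split_ifs with huw
  · rw [h, countSeries_apply, countSeries_apply, markings_restrict L huw.1 huw.2]
  · rw [countSeries_apply, markings_restrict_eq_empty L huw, Set.ncard_empty, Nat.cast_zero,
      mul_zero]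

theorem countSeries_congr (c : ℤ) {L L' : Language (Letter × Bool)} {u : List Letter}
    (h : ∀ p, selected p = u → (p ∈ L ↔ p ∈ L')) (w : List Letter) :
    countSeries c L u w = countSeries c L' u w := by
  rw [countSeries_apply, countSeries_apply]
  congr 3
  ext p
  exact ⟨fun hp => ⟨(h p hp.2.1).1 hp.1, hp.2⟩, fun hp => ⟨(h p hp.2.1).2 hp.1, hp.2⟩⟩

theorem countSeries_eq_zero (c : ℤ) {L : Language (Letter × Bool)} {u w : List Letter}
    (h : ∀ p, selected p = u → underlying p = w → p ∉ L) : countSeries c L u w = 0 := by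
  rw [countSeries_apply, Set.eq_empty_of_forall_notMem (s := markings L u w), Set.ncard_empty,
    Nat.cast_zero, mul_zero]
  rintro p ⟨hp, hu, hw⟩
  exact h p hu hw hp

theorem countSeries_eq_zero_of_not_sublist (c : ℤ) (L : Language (Letter × Bool))
    {u w : List Letter} (h : ¬ u.Sublist w) : countSeries c L u w = 0 := by
  refine countSeries_eq_zero c ?_
  rintro p rfl rfl
  exact absurd (selected_sublist p) h

/-! ### The zeta function and right-most embeddings -/

/-- The marking is right-most: between a marked letter and the next one there is no letter equal to
the former. The optional letter is the last marked one before the word. -/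
def IsRightmostMarking : Option Letter → List (Letter × Bool) → Prop
  | _, [] => True
  | _, (x, true) :: p => IsRightmostMarking (some x) p
  | s, (x, false) :: p => s ≠ some x ∧ IsRightmostMarking s p

/-- The language of right-most markings. -/
def rightmostLanguage (s : Option Letter) : Language (Letter × Bool) :=
  {p | IsRightmostMarking s p}

theorem isRegular_rightmostLanguage (s : Option Letter) : (rightmostLanguage s).IsRegular := by
  -- The invariant of a suffix is the set of preceding marked letters (or none) for which it is
  -- right-most.
  refine isRegular_of_finite (fun p s => IsRightmostMarking s p) ?_ ?_
  · rintro ⟨x, _ | _⟩ p q h <;> funext t <;> have h' := congrFun h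
    · simp only [IsRightmostMarking, h']
    · simp only [IsRightmostMarking, h']
  · exact fun p q h => (iff_of_eq (congrFun h s)).1

theorem countSeries_rightmost_true (c : ℤ) (s : Option Letter) (x : Letter) (u w : List Letter) :
    countSeries c (consQuotient (rightmostLanguage s) (x, true)) u w =
      countSeries c (rightmostLanguage (some x)) u w := rfl

theorem countSeries_rightmost_false (c : ℤ) (s : Option Letter) (x : Letter) (u w : List Letter) :
    countSeries c (consQuotient (rightmostLanguage s) (x, false)) u w =
      if s = some x then 0 else countSeries c (rightmostLanguage s) u w := by
  split_ifs with h
  · exact countSeries_eq_zero c fun p _ _ hp => hp.1 h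
  · exact countSeries_congr c (fun p _ => Iff.intro (fun hp => hp.2) fun hp => And.intro h hp) w

theorem cons_sublist_cons_of_ne {x y : Letter} (h : x ≠ y) {u w : List Letter} :
    (x :: u).Sublist (y :: w) ↔ (x :: u).Sublist w := by
  constructor
  · intro hs
    cases hs with
    | cons _ hs => exact hs
    | cons_cons => exact absurd rfl h
  · exact fun hs => hs.cons y

/-- If `x :: u` still embedded in `w`, the `x` marked just before `w` could be moved to the right.
-/
theorem countSeries_rightmost_some (x : Letter) (u w : List Letter) :
    countSeries 1 (rightmostLanguage (some x)) u w =
      if u.Sublist w ∧ ¬ (x :: u).Sublist w then 1 else 0 := by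
  induction w generalizing x u with
  | nil =>
    classical
    rw [countSeries_nil]
    refine if_congr ?_ rfl rfl
    simp only [List.sublist_nil, reduceCtorEq, not_false_eq_true, and_true]
    exact and_iff_left trivial
  | cons z w ih =>
    cases u with
    | nil =>
      rw [countSeries_cons_nil, countSeries_rightmost_false]
      by_cases h : x = z
      · subst h
        rw [if_pos rfl]
        simp
      · rw [if_neg (mt Option.some_inj.1 h), ih]
        simp [cons_sublist_cons_of_ne h]
    | cons y u =>
      rw [countSeries_cons_cons (by norm_num), countSeries_rightmost_false,
        countSeries_rightmost_true]
      have hyu : (y :: u).Sublist w → u.Sublist w := fun h => (List.sublist_cons_self y u).trans h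
      have hxyu : (x :: y :: u).Sublist w → (y :: u).Sublist w :=
        fun h => (List.sublist_cons_self x _).trans h
      by_cases h : x = z
      · subst h
        rw [if_pos rfl, ih]
        simp only [List.cons_sublist_cons]
        by_cases h' : y = x
        · subst h'
          simp
        · simp [h', cons_sublist_cons_of_ne h']
      · rw [if_neg (mt Option.some_inj.1 h), ih, ih]
        simp only [cons_sublist_cons_of_ne h]
        by_cases h' : y = z
        · subst h'
          simp only [List.cons_sublist_cons]
          by_cases h₁ : (y :: u).Sublist w
          · simp [h₁, hyu h₁]
          · simp [h₁, mt hxyu h₁]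
        · simp [h', cons_sublist_cons_of_ne h']

theorem countSeries_rightmost_none (u w : List Letter) :
    countSeries 1 (rightmostLanguage none) u w = if u.Sublist w then 1 else 0 := by
  induction w generalizing u with
  | nil =>
    classical
    rw [countSeries_nil]
    refine if_congr ?_ rfl rfl
    simp only [List.sublist_nil]
    exact and_iff_left trivial
  | cons z w ih =>
    cases u with
    | nil =>
      rw [countSeries_cons_nil, countSeries_rightmost_false, if_neg (Option.some_ne_none _).symm, ih]
      simp
    | cons y u =>
      rw [countSeries_cons_cons (by norm_num), countSeries_rightmost_false,
        countSeries_rightmost_true, if_neg (Option.some_ne_none _).symm, ih, countSeries_rightmost_some]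
      have hyu : (y :: u).Sublist w → u.Sublist w := fun h => (List.sublist_cons_self y u).trans h
      by_cases h' : y = z
      · subst h'
        simp only [List.cons_sublist_cons]
        by_cases h₁ : (y :: u).Sublist w
        · simp [h₁, hyu h₁]
        · simp [h₁]
      · simp [h', cons_sublist_cons_of_ne h']

theorem zetaSeries_eq (d : ℕ) :
    zetaSeries d = countSeries 1 (restrict d (rightmostLanguage none)) := by
  refine seriesOf_eq_countSeries fun u w => ?_
  rw [countSeries_rightmost_none, IncidenceAlgebra.zeta_apply]
  rfl

/-! ### Existence and uniqueness of the right-most embedding -/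

instance (u w : List Letter) : Finite (Embedding u w) :=
  inferInstanceAs (Finite
    {i : Fin u.length ↪o Fin w.length // ∀ j, u.get j = w.get (i j)})

theorem Embedding.sublist {u w : List Letter} (i : Embedding u w) : u.Sublist w :=
  List.sublist_iff_exists_fin_orderEmbedding_get_eq.2 ⟨i.1, i.2⟩

/-- The pointwise maximum of two embeddings. -/
def Embedding.max {u w : List Letter} (i i' : Embedding u w) : Embedding u w :=
  ⟨OrderEmbedding.ofStrictMono (fun j => Max.max (i.1 j) (i'.1 j))
    (fun _ _ h => max_lt_max (i.1.strictMono h) (i'.1.strictMono h)), fun j => by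
      change u.get j = w.get (Max.max (i.1 j) (i'.1 j))
      rcases max_choice (i.1 j) (i'.1 j) with h | h <;> rw [h]
      · exact i.2 j
      · exact i'.2 j⟩

theorem exists_isRightmost {u w : List Letter} (h : u.Sublist w) :
    ∃ i : Embedding u w, i.IsRightmost := by
  obtain ⟨i₀, h₀⟩ := List.sublist_iff_exists_fin_orderEmbedding_get_eq.1 h
  have : Nonempty (Embedding u w) := ⟨⟨i₀, h₀⟩⟩
  -- Embeddings are directed under pointwise comparison because of pointwise maxima; being finite in
  -- number, they have a common upper bound among them.
  have hdir : Directed (fun i i' : Embedding u w => ∀ j, i.1 j ≤ i'.1 j) id := fun i i' =>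
    ⟨i.max i', fun _ => le_max_left _ _, fun _ => le_max_right _ _⟩
  have : IsTrans (Embedding u w) (fun i i' => ∀ j, i.1 j ≤ i'.1 j) :=
    ⟨fun _ _ _ h₁ h₂ j => (h₁ j).trans (h₂ j)⟩
  exact hdir.finite_le id

/-- Comparing cardinalities suffices: both sides have one element if `u` is a subword of `w`, and
none otherwise. -/
theorem nonempty_markings_equiv_rightmost (u w : List Letter) :
    Nonempty (markings (rightmostLanguage none) u w ≃
      {i : Embedding u w // i.IsRightmost}) := by
  have : Finite (markings (rightmostLanguage none) u w) := finite_markings _ u w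
  rw [← Finite.card_eq, Nat.card_coe_set_eq]
  have hcount := countSeries_rightmost_none u w
  rw [countSeries_apply, one_pow, one_mul] at hcount
  split_ifs at hcount with h
  · obtain ⟨i, hi⟩ := exists_isRightmost h
    rw [Nat.cast_eq_one.1 hcount]
    refine (Nat.card_eq_one_iff_unique.2 ⟨⟨fun i i' => ?_⟩, ⟨⟨i, hi⟩⟩⟩).symm
    refine Subtype.ext (Subtype.ext (DFunLike.ext _ _ fun j => ?_))
    exact le_antisymm (i'.2 i.1 j) (i.2 i'.1 j)
  · rw [Nat.cast_eq_zero.1 hcount]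
    have : IsEmpty {i : Embedding u w // i.IsRightmost} := ⟨fun i => h i.1.sublist⟩
    exact Nat.card_of_isEmpty.symm

end WordPoset

namespace WordPoset

/-! ### Sums over subwords -/

/-- The sum of `g` over the distinct subwords of `w`. -/
def subwordSum (g : List Letter → ℤ) (w : List Letter) : ℤ :=
  ∑ v ∈ w.sublists.toFinset, g v

/-- The sum of `g` over the distinct subwords of `w` with first letter `x`. -/
def subwordSumHead (g : List Letter → ℤ) (x : Letter) (w : List Letter) : ℤ :=
  ∑ v ∈ w.sublists.toFinset with v.head? = some x, g v

theorem subwordSum_eq (g : List Letter → ℤ) (w : List Letter) :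
    subwordSum g w =
      g [] + subwordSumHead g Letter.a w + subwordSumHead g Letter.b w := by
  have h₀ : ∑ v ∈ w.sublists.toFinset with v.head? = none, g v = g [] := by
    rw [← Finset.sum_singleton g []]
    congr 1
    ext v
    simp only [Finset.mem_filter, List.mem_toFinset, List.mem_sublists, List.head?_eq_none_iff,
      Finset.mem_singleton]
    constructor
    · exact fun h => h.2
    · rintro rfl
      simp
  rw [subwordSum, ← Finset.sum_fiberwise _ List.head?, Fintype.sum_option, h₀, add_assoc]
  congr 1
  exact Finset.sum_pair (by simp)

theorem cons_sublist_append_cons {x : Letter} {r : List Letter} (hr : x ∉ r) (u w : List Letter) :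
    (x :: u).Sublist (r ++ x :: w) ↔ u.Sublist w := by
  induction r with
  | nil => exact List.cons_sublist_cons
  | cons y r ih =>
    rw [List.mem_cons, not_or] at hr
    rw [List.cons_append, cons_sublist_cons_of_ne hr.1, ih hr.2]

/-- The initial `x` of a subword can always be matched greedily with the first `x` of the word, so
each distinct subword is counted once. -/
theorem subwordSumHead_append_cons (g : List Letter → ℤ) {x : Letter} {r : List Letter}
    (hr : x ∉ r) (w : List Letter) :
    subwordSumHead g x (r ++ x :: w) = subwordSum (fun v => g (x :: v)) w := by
  rw [subwordSumHead, subwordSum, ← Finset.sum_image (f := g) List.cons_injective.injOn]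
  congr 1
  ext v
  simp only [Finset.mem_filter, List.mem_toFinset, List.mem_sublists, Finset.mem_image]
  constructor
  · rintro ⟨h, hx⟩
    obtain ⟨v, rfl⟩ := List.head?_eq_some_iff.1 hx
    exact ⟨v, (cons_sublist_append_cons hr v w).1 h, rfl⟩
  · rintro ⟨v, h, rfl⟩
    exact ⟨(cons_sublist_append_cons hr v w).2 h, rfl⟩

theorem subwordSumHead_of_notMem (g : List Letter → ℤ) {x : Letter} {w : List Letter}
    (h : x ∉ w) : subwordSumHead g x w = 0 := by
  rw [subwordSumHead, Finset.filter_false_of_mem, Finset.sum_empty]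
  intro v hv hx
  obtain ⟨v, rfl⟩ := List.head?_eq_some_iff.1 hx
  rw [List.mem_toFinset, List.mem_sublists] at hv
  exact h (hv.subset List.mem_cons_self)

theorem cons_suffix_append_cons {x : Letter} {r : List Letter} (hr : x ∉ r) (u w : List Letter) :
    x :: u <:+ r ++ x :: w ↔ u = w ∨ x :: u <:+ w := by
  induction r with
  | nil => simp [List.suffix_cons_iff]
  | cons y r ih =>
    rw [List.mem_cons, not_or] at hr
    rw [List.cons_append, List.suffix_cons_iff, ih hr.2, or_iff_right]
    exact fun h => hr.1 (List.cons_eq_cons.1 h).1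

/-! ### Normal markings -/

/-- `u` starts with a nonempty run of `d` letters `b`. -/
def StartsWithRun (d : ℕ) (u : List Letter) : Prop :=
  0 < d ∧ List.replicate d Letter.b <+: u

/-- What has to be remembered of the part of a marked word already read: its last letter, and
whether a maximal run of `b` may start to be marked. -/
inductive NormalState where
  | start
  | aGood
  | aBad
  | bLast

namespace NormalState

instance : Finite NormalState :=
  Finite.of_injective (fun s : NormalState =>
    match s with
    | start => (0 : Fin 4)
    | aGood => 1
    | aBad => 2
    | bLast => 3) (by intro s t; cases s <;> cases t <;> simp)

/-- The last letter read. -/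
def last : NormalState → Option Letter
  | start => none
  | aGood => some Letter.a
  | aBad => some Letter.a
  | bLast => some Letter.b

/-- Whether a run of `d` letters `b` may start to be marked. -/
def Good : NormalState → Prop
  | start => True
  | aGood => True
  | aBad => False
  | bLast => False

/-- The state after reading a letter. -/
def next : NormalState → Letter → Bool → NormalState
  | _, Letter.b, _ => bLast
  | _, Letter.a, true => aGood
  | start, Letter.a, false => aGood
  -- An unmarked `a` right after an `a` violates normality, so the values here and at `aBad` are
  -- immaterial.
  | aGood, Letter.a, false => aGood
  | aBad, Letter.a, false => aBad
  | bLast, Letter.a, false => aBad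

end NormalState

/-- The normality condition on the markings of the letters to be read in a given state. -/
def IsNormalMarking (d : ℕ) : NormalState → List (Letter × Bool) → Prop
  | _, [] => True
  | s, (x, m) :: p => (s.last = some x → m = true) ∧
      (m = true → StartsWithRun d (x :: selected p) → s.Good) ∧
        IsNormalMarking d (s.next x m) p

/-- The language of normal markings. -/
def normalLanguage (d : ℕ) (s : NormalState) : Language (Letter × Bool) :=
  {p | IsNormalMarking d s p}

theorem isRegular_normalLanguage (d : ℕ) (s : NormalState) : (normalLanguage d s).IsRegular := by
  -- The run profile of the marked subword is needed to decide whether a newly marked letter starts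
  -- a run of `d` letters `b`.
  refine isRegular_of_finite
    (fun p => (runProfile d (selected p), fun s => IsNormalMarking d s p)) ?_ ?_
  · rintro ⟨x, m⟩ p q h
    obtain ⟨h₁, h₂⟩ := Prod.mk.inj h
    refine Prod.ext (runProfile_selected_cons h₁ _) (funext fun t => ?_)
    simp only [IsNormalMarking, StartsWithRun, congrFun h₂,
      replicate_prefix_cons_iff h₁ x (by omega : d < d + 2)]
  · exact fun p q h => (iff_of_eq (congrFun (Prod.mk.inj h).2 s)).1

theorem countSeries_normal_false (c : ℤ) (d : ℕ) (s : NormalState) (x : Letter)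
    (u w : List Letter) :
    countSeries c (consQuotient (normalLanguage d s) (x, false)) u w =
      if s.last = some x then 0 else countSeries c (normalLanguage d (s.next x false)) u w := by
  split_ifs with h
  · exact countSeries_eq_zero c fun p _ _ hp => absurd (hp.1 h) Bool.false_ne_true
  · refine countSeries_congr c (fun p _ => Iff.intro (fun hp => hp.2.2) fun hp => ?_) w
    exact ⟨fun h' => absurd h' h, fun h' => absurd h' Bool.false_ne_true, hp⟩

open Classical in
theorem countSeries_normal_true (c : ℤ) (d : ℕ) (s : NormalState) (x : Letter)
    (u w : List Letter) :
    countSeries c (consQuotient (normalLanguage d s) (x, true)) u w =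
      if StartsWithRun d (x :: u) ∧ ¬ s.Good then 0
      else countSeries c (normalLanguage d (s.next x true)) u w := by
  split_ifs with h
  · refine countSeries_eq_zero c ?_
    rintro p rfl - hp
    exact h.2 (hp.2.1 rfl h.1)
  · refine countSeries_congr c ?_ w
    rintro p rfl
    exact Iff.intro (fun hp => hp.2.2) fun hp =>
      ⟨fun _ => rfl, fun _ h' => not_not.1 fun hg => h ⟨h', hg⟩, hp⟩

/-- The signed number of normal markings of `u` in subwords of `w`. -/
noncomputable def normalSubwordSum (d : ℕ) (s : NormalState) (u w : List Letter) : ℤ :=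
  subwordSum (countSeries (-1) (normalLanguage d s) u) w

open Classical in
/-- The value of `normalSubwordSum` on words of `A*_d`. -/
noncomputable def normalSubwordValue (d : ℕ) (s : NormalState) (u w : List Letter) : ℤ :=
  match s.last with
  | none => if u = w then 1 else 0
  -- The last condition says that `x :: u` is a suffix of `x :: w`, where `x` is the letter just
  -- read.
  | some x => if StartsWithRun d u ∧ ¬ s.Good then 0 else if u = w ∨ x :: u <:+ w then 1 else 0

theorem StartsWithRun.exists_cons {d : ℕ} {u : List Letter} (h : StartsWithRun d u) :
    ∃ v, u = Letter.b :: v := by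
  obtain ⟨h, v, rfl⟩ := h
  obtain ⟨d, rfl⟩ := Nat.exists_eq_succ_of_ne_zero h.ne'
  exact ⟨_, rfl⟩

theorem StartsWithRun.not_inAd_cons {d : ℕ} {u : List Letter} (h : StartsWithRun d u) :
    ¬ InAd d (Letter.b :: u) := fun h' => (inAd_cons.1 h').1 <| by
  rw [List.replicate_succ, List.cons_prefix_cons]
  exact ⟨rfl, h.2⟩

open Classical in
theorem normalSubwordValue_next_false {d : ℕ} {s : NormalState} {x : Letter} {r : List Letter}
    (hr : x ∉ r) (u w : List Letter) :
    normalSubwordValue d (s.next x false) u w =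
      if StartsWithRun d u ∧ ¬ (s.next x false).Good then 0
      else if x :: u <:+ r ++ x :: w then 1 else 0 := by
  have : (s.next x false).last = some x := by cases s <;> cases x <;> rfl
  rw [normalSubwordValue, this]
  simp only [cons_suffix_append_cons hr]

-- No obstruction from runs remains: a marked `a` leads to a good state, and after a marked `b` a
-- run of `d` letters `b` in `u` would put `d + 1` of them into `x :: u`.
open Classical in
theorem normalSubwordValue_next_true {d : ℕ} {s : NormalState} {x : Letter} {r : List Letter}
    (hr : x ∉ r) (u w : List Letter) (hu : InAd d (x :: u)) :
    normalSubwordValue d (s.next x true) u w = if x :: u <:+ r ++ x :: w then 1 else 0 := by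
  have : (s.next x true).last = some x := by cases s <;> cases x <;> rfl
  rw [normalSubwordValue, this]
  simp only [cons_suffix_append_cons hr]
  rw [if_neg]
  rintro ⟨h, h'⟩
  cases x
  · cases s <;> exact h' trivial
  · exact h.not_inAd_cons hu

-- Cut `w` after its first `x` and apply induction to the rest. The first indicator comes from
-- marking the initial `x` of the subword, the second, with sign `-1`, from leaving it unmarked.
open Classical in
theorem subwordSumHead_normal {d : ℕ} (s : NormalState) (x : Letter) {u w : List Letter}
    (hu : InAd d u) (hw : InAd d w)
    (ih : ∀ w', w'.length < w.length → InAd d w' → ∀ s u, InAd d u →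
      normalSubwordSum d s u w' = normalSubwordValue d s u w') :
    subwordSumHead (countSeries (-1) (normalLanguage d s) u) x w =
      (if u.head? = some x ∧ ¬ (StartsWithRun d u ∧ ¬ s.Good) ∧ u <:+ w then 1 else 0) -
        if s.last ≠ some x ∧ ¬ (StartsWithRun d u ∧ ¬ (s.next x false).Good) ∧ x :: u <:+ w
        then 1 else 0 := by
  by_cases hx : x ∈ w
  · obtain ⟨r, w', rfl, hr⟩ := List.eq_append_cons_of_mem hx
    have hw' : InAd d w' := hw.of_infix ((List.suffix_cons x w').trans
      (List.suffix_append r (x :: w'))).isInfix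
    have ih' := ih w' (by simp; omega) hw'
    rw [subwordSumHead_append_cons _ hr]
    have hfalse : subwordSum (countSeries (-1) (consQuotient (normalLanguage d s) (x, false)) u) w'
        = if s.last ≠ some x ∧ ¬ (StartsWithRun d u ∧ ¬ (s.next x false).Good) ∧
            x :: u <:+ r ++ x :: w' then 1 else 0 := by
      simp only [subwordSum, countSeries_normal_false]
      by_cases h : s.last = some x
      · simp [h]
      · simp only [if_neg h]
        refine (ih' (s.next x false) u hu).trans ?_
        rw [normalSubwordValue_next_false hr]
        by_cases h₁ : StartsWithRun d u ∧ ¬ (s.next x false).Good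
        · simp [h₁]
        · simp only [h₁, h, if_false, ne_eq, not_false_eq_true, true_and]
    rw [← hfalse]
    cases u with
    | nil =>
      simp [countSeries_cons_nil, subwordSum]
    | cons y u =>
      simp only [countSeries_cons_cons (c := -1) (by norm_num), subwordSum, Finset.sum_add_distrib,
        List.head?_cons, Option.some_inj]
      by_cases hy : y = x
      · subst hy
        have htrue : subwordSum (countSeries (-1) (normalLanguage d (s.next y true)) u) w' = _ :=
          (ih' (s.next y true) u hu.tail).trans (normalSubwordValue_next_true hr u w' hu)
        simp only [countSeries_normal_true, if_true, true_and]
        by_cases h₁ : StartsWithRun d (y :: u) ∧ ¬ s.Good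
        · simp [h₁]
        · simp only [h₁, if_false, not_false_eq_true, true_and]
          rw [← htrue, subwordSum]
          simp
          ring
      · simp [hy]
  · rw [subwordSumHead_of_notMem _ hx, if_neg, if_neg, sub_zero]
    · rintro ⟨-, -, h⟩
      exact hx (h.subset List.mem_cons_self)
    · rintro ⟨h, -, h'⟩
      obtain ⟨v, rfl⟩ := List.head?_eq_some_iff.1 h
      exact hx (h'.subset List.mem_cons_self)

theorem suffix_iff_eq_or_cons_suffix (u w : List Letter) :
    u <:+ w ↔ u = w ∨ Letter.a :: u <:+ w ∨ Letter.b :: u <:+ w := by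
  constructor
  · rintro ⟨r, rfl⟩
    rcases List.eq_nil_or_concat r with rfl | ⟨r, x, rfl⟩
    · exact Or.inl rfl
    · cases x
      · exact Or.inr (Or.inl ⟨r, by simp⟩)
      · exact Or.inr (Or.inr ⟨r, by simp⟩)
  · rintro (rfl | h | h)
    · exact List.suffix_rfl
    · exact (List.suffix_cons _ _).trans h
    · exact (List.suffix_cons _ _).trans h

theorem not_cons_suffix_of_cons_suffix {u w : List Letter} (h : Letter.a :: u <:+ w) :
    ¬ Letter.b :: u <:+ w := fun h' => by
  simpa using (List.suffix_of_suffix_length_le h h' (by simp)).eq_of_length (by simp)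

theorem not_cons_suffix_self (x : Letter) (u : List Letter) : ¬ x :: u <:+ u := fun h => by
  simpa using h.length_le

/-- The word `u` is a suffix of `w` in exactly one of three ways: it equals `w`, or is preceded
there by `a`, or by `b`. Unmarked first letters cancel the last two, except that a letter repeating
the last one read must be marked; this is why the indicator of `x :: u <:+ w` survives in a state
with last letter `x`. -/
theorem normalSubwordSum_eq {d : ℕ} (s : NormalState) {u w : List Letter} (hu : InAd d u)
    (hw : InAd d w) : normalSubwordSum d s u w = normalSubwordValue d s u w := by
  classical
  induction hn : w.length using Nat.strong_induction_on generalizing s u w with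
  | _ n ih =>
    subst hn
    have ih' : ∀ w', w'.length < w.length → InAd d w' → ∀ s u, InAd d u →
        normalSubwordSum d s u w' = normalSubwordValue d s u w' :=
      fun w' hl hw' s u hu => ih _ hl s hu hw' rfl
    rw [normalSubwordSum, subwordSum_eq, subwordSumHead_normal s _ hu hw ih',
      subwordSumHead_normal s _ hu hw ih', countSeries_nil]
    have hmem : [] ∈ normalLanguage d s := trivial
    -- If `u` starts with a run, an unmarked `b` leads to a bad state and cancels nothing; but there
    -- is nothing to cancel, as `w` has no `d + 1` consecutive `b`'s.
    have hrun : StartsWithRun d u → ¬ Letter.b :: u <:+ w := fun h h' =>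
      h.not_inAd_cons (hw.of_infix h'.isInfix)
    have hhead : StartsWithRun d u → u.head? = some Letter.b := by
      intro h
      obtain ⟨v, rfl⟩ := h.exists_cons
      rfl
    have hsuf := suffix_iff_eq_or_cons_suffix u w
    have hab := @not_cons_suffix_of_cons_suffix u w
    have heq : ∀ x, u = w → ¬ x :: u <:+ w := by
      rintro x rfl
      exact not_cons_suffix_self x u
    have ha := heq Letter.a
    have hb := heq Letter.b
    simp only [hmem, and_true]
    rw [normalSubwordValue]
    clear ih ih' heq hu hw
    -- The empty subword and the two choices of a marked first letter correspond to `u` being empty,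
    -- starting with `a`, or starting with `b`.
    have hcond : (if u = [] then 1 else 0 : ℤ) +
        (if u.head? = some Letter.a ∧ ¬ (StartsWithRun d u ∧ ¬ s.Good) ∧ u <:+ w then 1 else 0) +
        (if u.head? = some Letter.b ∧ ¬ (StartsWithRun d u ∧ ¬ s.Good) ∧ u <:+ w then 1 else 0) =
        if StartsWithRun d u ∧ ¬ s.Good then 0 else if u <:+ w then 1 else 0 := by
      by_cases hR : StartsWithRun d u
      · have h := hhead hR
        have h₀ : u ≠ [] := by
          rintro rfl
          simp at h
        by_cases hg : s.Good <;> by_cases hS : u <:+ w <;> simp [h, hR, hg, hS, h₀]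
      · rcases u with _ | ⟨_ | _, u⟩ <;> simp [hR]
    rw [add_assoc, sub_add_sub_comm, ← add_sub_assoc, ← add_assoc, hcond]
    simp only [hsuf]
    clear hcond hsuf hhead hmem
    by_cases hE : u = w
    · have hA := ha hE
      have hB := hb hE
      simp only [eq_true hE, hA, hB]
      cases s <;> simp [NormalState.last, NormalState.Good]
    · by_cases hA : Letter.a :: u <:+ w
      · have hB := hab hA
        simp only [hE, hA, hB]
        cases s <;> simp [NormalState.last, NormalState.next, NormalState.Good, hA, hB]
      · by_cases hB : Letter.b :: u <:+ w
        · have hR : ¬ StartsWithRun d u := fun h => hrun h hB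
          simp only [hE, hA, hB, hR]
          cases s <;> simp [NormalState.last, hA, hB]
        · simp only [hE, hA, hB]
          cases s <;> simp [NormalState.last, hA, hB]

/-! ### The Möbius function -/

/-- After a `b`, the next `b`'s in the same run must all be marked; `d` of them would start a marked
run in a bad state. -/
theorem IsNormalMarking.not_replicate_prefix {d : ℕ} (hd : 0 < d) {p : List (Letter × Bool)}
    (h : IsNormalMarking d NormalState.bLast p) :
    ¬ List.replicate d Letter.b <+: underlying p := by
  have key : ∀ (k : ℕ) (p : List (Letter × Bool)), IsNormalMarking d NormalState.bLast p →
      List.replicate k Letter.b <+: underlying p → List.replicate k Letter.b <+: selected p := by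
    intro k
    induction k with
    | zero => simp
    | succ k ih =>
      rintro (_ | ⟨⟨x, m⟩, p⟩) hp hk
      · simp at hk
      · rw [underlying_cons, List.replicate_succ, List.cons_prefix_cons] at hk
        obtain ⟨rfl, hk⟩ := hk
        obtain rfl := hp.1 rfl
        rw [selected_cons_true, List.replicate_succ, List.cons_prefix_cons]
        exact ⟨rfl, ih p hp.2.2 hk⟩
  intro hk
  have hsel := key d p h hk
  rcases p with _ | ⟨⟨x, m⟩, p⟩
  · obtain ⟨d, rfl⟩ := Nat.exists_eq_succ_of_ne_zero hd.ne'
    simp at hk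
  · obtain ⟨d, rfl⟩ := Nat.exists_eq_succ_of_ne_zero hd.ne'
    rw [underlying_cons, List.replicate_succ, List.cons_prefix_cons] at hk
    obtain ⟨rfl, hk⟩ := hk
    obtain rfl := h.1 rfl
    exact h.2.1 rfl ⟨hd, hsel⟩

theorem IsNormalMarking.inAd_underlying {d : ℕ} (hd : 0 < d) {s : NormalState}
    {p : List (Letter × Bool)} (h : IsNormalMarking d s p) : InAd d (underlying p) := by
  induction p generalizing s with
  | nil => simp [InAd]
  | cons e p ih =>
    obtain ⟨x, m⟩ := e
    rw [underlying_cons, inAd_cons]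
    refine ⟨fun hk => ?_, ih h.2.2⟩
    rw [List.replicate_succ, List.cons_prefix_cons] at hk
    obtain ⟨rfl, hk⟩ := hk
    have h' := h.2.2
    cases s <;> exact h'.not_replicate_prefix hd hk

/-- This lets the sum over an interval of `A*_d` be extended to all subwords. For `d > 0` a word
with a normal marking lies in `A*_d`; for `d = 0` this fails, but `A*_0` is closed under subwords.
-/
theorem countSeries_normal_eq_zero {d : ℕ} (c : ℤ) (s : NormalState) (u : List Letter)
    {v w : List Letter} (hw : InAd d w) (hv : v.Sublist w) (h : ¬ InAd d v) :
    countSeries c (normalLanguage d s) u v = 0 := by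
  rcases Nat.eq_zero_or_pos d with rfl | hd
  · refine absurd ?_ h
    simp only [InAd, zero_add, List.replicate_one, List.singleton_infix_iff] at hw ⊢
    exact fun hb => hw (hv.subset hb)
  · refine countSeries_eq_zero c ?_
    rintro p - rfl hp
    exact h (IsNormalMarking.inAd_underlying hd hp)

/-- The signed number of normal markings, as an element of the incidence algebra. -/
noncomputable def normalCount (d : ℕ) : IncidenceAlgebra ℤ (Word d) where
  toFun u w := countSeries (-1) (normalLanguage d NormalState.start) u.letters w.letters
  eq_zero_of_not_le' _ _ h := countSeries_eq_zero_of_not_sublist _ _ h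

theorem normalCount_mul_zeta (d : ℕ) : normalCount d * IncidenceAlgebra.zeta ℤ = 1 := by
  ext u w -
  have h := normalSubwordSum_eq NormalState.start u.mem w.mem
  rw [IncidenceAlgebra.mul_apply, IncidenceAlgebra.one_apply]
  have hval : normalSubwordValue d NormalState.start u.letters w.letters =
      if u = w then 1 else 0 := by
    simp only [normalSubwordValue, NormalState.last, Word.ext_iff]
  rw [← hval, ← h, normalSubwordSum, subwordSum]
  refine (Finset.sum_congr rfl fun v hv => ?_).trans
    ((Finset.sum_image (s := Finset.Icc u w) (g := Word.letters)
      (f := countSeries (-1) (normalLanguage d NormalState.start) u.letters)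
      fun _ _ _ _ h => Word.ext h).symm.trans (Finset.sum_subset ?_ ?_))
  · rw [IncidenceAlgebra.zeta_of_le (Finset.mem_Icc.1 hv).2, mul_one]
    rfl
  · intro v hv
    obtain ⟨v, hvI, rfl⟩ := Finset.mem_image.1 hv
    rw [List.mem_toFinset, List.mem_sublists]
    exact (Finset.mem_Icc.1 hvI).2
  · intro v hv hv'
    rw [List.mem_toFinset, List.mem_sublists] at hv
    by_cases hd : InAd d v
    · refine countSeries_eq_zero_of_not_sublist _ _ fun huv => hv' ?_
      exact Finset.mem_image.2 ⟨⟨v, hd⟩, Finset.mem_Icc.2 ⟨huv, hv⟩, rfl⟩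
    · exact countSeries_normal_eq_zero _ _ _ w.mem hv hd

theorem muSeries_eq (d : ℕ) :
    muSeries d = countSeries (-1) (restrict d (normalLanguage d NormalState.start)) := by
  refine seriesOf_eq_countSeries fun u w => ?_
  -- A left inverse of `ζ` equals its right inverse `μ`.
  have : IncidenceAlgebra.mu ℤ = normalCount d := by
    rw [← one_mul (IncidenceAlgebra.mu ℤ), ← normalCount_mul_zeta, mul_assoc,
      IncidenceAlgebra.zeta_mul_mu, mul_one]
  rw [this]
  rfl

end WordPoset

namespace WordPoset

/-! ### Embeddings as markings -/

/-- The second conclusion, about the part before a marked position, is what turns conditions on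
suffixes of `u` into conditions on suffixes of the marked word. -/
theorem selected_eq_of_positions {p : List (Letter × Bool)} {u : List Letter}
    {f : Fin u.length → ℕ} (hf : StrictMono f) (h₁ : ∀ j, p[f j]? = some (u.get j, true))
    (h₂ : ∀ q x, p[q]? = some (x, true) → ∃ j, f j = q) :
    selected p = u ∧ ∀ j, selected (p.take (f j)) = u.take j := by
  induction p generalizing u with
  | nil =>
    rcases u with _ | ⟨y, u⟩
    · exact ⟨rfl, fun j => j.elim0⟩
    · simpa using h₁ ⟨0, by simp⟩
  | cons e p ih =>
    obtain ⟨x, _ | _⟩ := e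
    · have hpos : ∀ j, f j = (f j - 1) + 1 := by
        intro j
        rcases Nat.eq_zero_or_pos (f j) with h | h
        · have := h₁ j
          simp [h] at this
        · omega
      obtain ⟨hp, ht⟩ := ih (u := u) (f := fun j => f j - 1)
        (fun i j hij => by
          have := hf hij
          have := hpos i
          change f i - 1 < f j - 1
          omega)
        (fun j => by
          have := h₁ j
          rwa [hpos j, List.getElem?_cons_succ] at this)
        (fun q y hq => by
          obtain ⟨j, hj⟩ := h₂ (q + 1) y (by rwa [List.getElem?_cons_succ])
          exact ⟨j, by omega⟩)
      refine ⟨hp, fun j => ?_⟩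
      rw [hpos j, List.take_succ_cons, selected_cons_false]
      exact ht j
    · obtain ⟨j₀, hj₀⟩ := h₂ 0 x rfl
      rcases u with _ | ⟨y, u⟩
      · exact j₀.elim0
      have h0 : f 0 = 0 := by
        have := hf.monotone (Fin.zero_le j₀)
        omega
      have hy := h₁ 0
      rw [h0] at hy
      obtain rfl : x = y := by simpa using hy
      have hpos : ∀ j : Fin u.length, f j.succ = (f j.succ - 1) + 1 := by
        intro j
        have := hf (Fin.succ_pos j)
        omega
      obtain ⟨hp, ht⟩ := ih (u := u) (f := fun j => f j.succ - 1)
        (fun i j hij => by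
          have := hf (Fin.succ_lt_succ_iff.2 hij)
          have := hpos i
          change f i.succ - 1 < f j.succ - 1
          omega)
        (fun j => by
          have := h₁ j.succ
          rw [hpos j, List.getElem?_cons_succ] at this
          exact this)
        (fun q y hq => by
          obtain ⟨j, hj⟩ := h₂ (q + 1) y (by rwa [List.getElem?_cons_succ])
          rcases Fin.eq_zero_or_eq_succ j with rfl | ⟨j, rfl⟩
          · omega
          · exact ⟨j, by omega⟩)
      refine ⟨by rw [selected_cons_true, hp], fun j => ?_⟩
      rcases Fin.eq_zero_or_eq_succ j with rfl | ⟨j, rfl⟩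
      · rw [h0]
        rfl
      · rw [hpos j, List.take_succ_cons, selected_cons_true, ht j]
        rfl

theorem exists_positions (p : List (Letter × Bool)) :
    ∃ f : Fin (selected p).length → ℕ, StrictMono f ∧
      (∀ j, p[f j]? = some ((selected p).get j, true)) ∧
        ∀ q x, p[q]? = some (x, true) → ∃ j, f j = q := by
  induction p with
  | nil => exact ⟨fun j => j.elim0, fun j => j.elim0, fun j => j.elim0, fun q x h => by simp at h⟩
  | cons e p ih =>
    obtain ⟨f, hf, h₁, h₂⟩ := ih
    obtain ⟨x, _ | _⟩ := e
    · refine ⟨fun j => f j + 1, fun i j h => Nat.succ_lt_succ (hf h), fun j => h₁ j, ?_⟩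
      rintro (_ | q) y hq
      · simp at hq
      · obtain ⟨j, hj⟩ := h₂ q y hq
        exact ⟨j, congrArg Nat.succ hj⟩
    · change ∃ g : Fin ((selected p).length + 1) → ℕ, _
      refine ⟨Fin.cons (n := (selected p).length) (α := fun _ => ℕ) 0 fun j => f j + 1, ?_, ?_, ?_⟩
      · intro (i : Fin ((selected p).length + 1)) (j : Fin ((selected p).length + 1)) h
        induction j using Fin.cases with
        | zero => exact absurd h (Fin.not_lt_zero _)
        | succ j =>
          induction i using Fin.cases with
          | zero => simp
          | succ i =>
            simp only [Fin.cons_succ]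
            exact Nat.succ_lt_succ (hf (Fin.succ_lt_succ_iff.1 h))
      · intro (j : Fin ((selected p).length + 1))
        induction j using Fin.cases with
        | zero => rfl
        | succ j => exact h₁ j
      · rintro (_ | q) y hq
        · exact ⟨(0 : Fin ((selected p).length + 1)), rfl⟩
        · obtain ⟨j, hj⟩ := h₂ q y hq
          exact ⟨Fin.succ j, congrArg Nat.succ hj⟩

namespace Embedding

variable {u w : List Letter} (i : Embedding u w)

open Classical in
/-- The marking of `w` at the positions of an embedding. -/
noncomputable def marking : List (Letter × Bool) :=
  List.ofFn fun q => (w.get q, decide (q ∈ Set.range i.1))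

theorem length_marking : i.marking.length = w.length := List.length_ofFn

open Classical in
theorem getElem_marking (q : ℕ) (hq : q < i.marking.length) :
    i.marking[q] = (w[q]'(i.length_marking ▸ hq),
      decide ((⟨q, i.length_marking ▸ hq⟩ : Fin w.length) ∈ Set.range i.1)) := by
  simp [marking]

theorem underlying_marking : underlying i.marking = w := by
  rw [underlying, marking, List.map_ofFn]
  exact List.ofFn_get w

theorem getElem?_marking_eq_some_true {q : ℕ} {x : Letter} :
    i.marking[q]? = some (x, true) ↔ ∃ j, (i.1 j : ℕ) = q ∧ u.get j = x := by
  rw [List.getElem?_eq_some_iff]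
  constructor
  · rintro ⟨hq, h⟩
    rw [getElem_marking, Prod.mk.injEq, decide_eq_true_eq] at h
    obtain ⟨h, j, hj⟩ := h
    exact ⟨j, congrArg Fin.val hj, by rw [i.2 j, hj]; exact h⟩
  · rintro ⟨j, rfl, rfl⟩
    refine ⟨(i.1 j).2.trans_eq i.length_marking.symm, ?_⟩
    rw [getElem_marking, Prod.mk.injEq, decide_eq_true_eq]
    exact ⟨(i.2 j).symm, j, rfl⟩

theorem selected_marking_and_take : selected i.marking = u ∧
    ∀ j, selected (i.marking.take (i.1 j)) = u.take j := by
  refine selected_eq_of_positions (f := fun j => (i.1 j : ℕ)) (fun j k h => i.1.strictMono h)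
    (fun j => i.getElem?_marking_eq_some_true.2 ⟨j, rfl, rfl⟩) fun q x h => ?_
  obtain ⟨j, hj, -⟩ := i.getElem?_marking_eq_some_true.1 h
  exact ⟨j, hj⟩

theorem selected_marking : selected i.marking = u := i.selected_marking_and_take.1

theorem selected_take_marking (j : Fin u.length) :
    selected (i.marking.take (i.1 j)) = u.take j := i.selected_marking_and_take.2 j

theorem selected_drop_marking (j : Fin u.length) :
    selected (i.marking.drop (i.1 j)) = u.drop j := by
  have h := selected_append (i.marking.take (i.1 j)) (i.marking.drop (i.1 j))
  rw [List.take_append_drop, selected_marking, selected_take_marking] at h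
  exact (List.append_cancel_left ((List.take_append_drop _ _).trans h)).symm

theorem marking_injective : Function.Injective (marking : Embedding u w → _) := by
  intro i i' h
  refine Subtype.ext ?_
  -- An increasing map on a finite chain is determined by its range, which is the set of marked
  -- positions.
  rw [← OrderEmbedding.range_inj]
  ext q
  have key : ∀ k : Embedding u w, q ∈ Set.range k.1 ↔ k.marking[q.1]? = some (w.get q, true) := by
    intro k
    rw [getElem?_marking_eq_some_true]
    constructor
    · rintro ⟨j, rfl⟩
      exact ⟨j, rfl, k.2 j⟩
    · rintro ⟨j, hj, -⟩
      exact ⟨j, Fin.ext hj⟩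
  rw [key, key, h]

theorem exists_marking_eq (p : List (Letter × Bool)) :
    ∃ i : Embedding (selected p) (underlying p), i.marking = p := by
  obtain ⟨f, hf, h₁, h₂⟩ := exists_positions p
  have hlt : ∀ j, f j < (underlying p).length := fun j => by
    rw [underlying, List.length_map]
    exact (List.getElem?_eq_some_iff.1 (h₁ j)).1
  obtain ⟨i, hi⟩ : ∃ i : Embedding (selected p) (underlying p), ∀ j, (i.1 j : ℕ) = f j := by
    refine ⟨⟨OrderEmbedding.ofStrictMono (fun j => ⟨f j, hlt j⟩)
      (fun {_ _} h => Fin.lt_def.2 (hf h)), fun j => ?_⟩, fun j => rfl⟩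
    obtain ⟨hj, h⟩ := List.getElem?_eq_some_iff.1 (h₁ j)
    change (selected p).get j = (underlying p)[f j]'(hlt j)
    simp [underlying, h]
  refine ⟨i, List.ext_getElem (by rw [length_marking, underlying, List.length_map]) ?_⟩
  intro q hq hq'
  rw [getElem_marking]
  refine Prod.ext (by simp [underlying]) ?_
  rw [Bool.eq_iff_iff, decide_eq_true_eq]
  constructor
  · rintro ⟨j, hj⟩
    obtain ⟨hj', h⟩ := List.getElem?_eq_some_iff.1 (h₁ j)
    obtain rfl : f j = q := (hi j).symm.trans (congrArg Fin.val hj)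
    rw [h]
  · intro h
    obtain ⟨j, hj⟩ := h₂ q (p[q].1) (List.getElem?_eq_some_iff.2 ⟨hq', Prod.ext rfl h⟩)
    exact ⟨j, Fin.ext ((hi j).trans hj)⟩

theorem nonempty_markings_equiv (L : Language (Letter × Bool)) (u w : List Letter) :
    Nonempty (markings L u w ≃ {i : Embedding u w // i.marking ∈ L}) := by
  refine ⟨(Equiv.ofBijective (fun i : {i : Embedding u w // i.marking ∈ L} =>
    (⟨i.1.marking, i.2, i.1.selected_marking, i.1.underlying_marking⟩ : markings L u w))
    ⟨fun i i' h => Subtype.ext (marking_injective (congrArg Subtype.val h)), ?_⟩).symm⟩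
  rintro ⟨p, hp, rfl, rfl⟩
  obtain ⟨i, hi⟩ := exists_marking_eq p
  exact ⟨⟨i, hi.symm ▸ hp⟩, Subtype.ext hi⟩

end Embedding

/-! ### Normal embeddings -/

/-- A run of `d` letters `b` may start to be marked after `r`. -/
def GoodPrefix (r : List (Letter × Bool)) : Prop :=
  (selected r ≠ [] → r.getLast? = some (Letter.a, true)) ∧
    (selected r = [] → Letter.b ∉ underlying r)

/-- The delicate case is an unmarked `a`: by `hm` the previous letter is not an `a`, so the run may
start only if nothing has been marked and no `b` read. -/
theorem next_good_iff {s : NormalState} {r : List (Letter × Bool)} {x : Letter} {m : Bool}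
    (hlast : s.last = r.getLast?.map Prod.fst) (hgood : s.Good ↔ GoodPrefix r)
    (hm : s.last = some x → m = true) :
    (s.next x m).Good ↔ GoodPrefix (r ++ [(x, m)]) := by
  rcases x with _ | _ <;> rcases m with _ | _
  · have hna : s.last ≠ some Letter.a := fun h => Bool.false_ne_true (hm h)
    have hnext : (s.next Letter.a false).Good ↔ s.Good := by
      cases s <;> simp [NormalState.next, NormalState.Good]
    have hne : r.getLast? ≠ some (Letter.a, true) := fun h => hna (by rw [hlast, h]; rfl)
    rw [hnext, hgood]
    simp [GoodPrefix, selected_append, underlying_append, hne]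
  · have hnext : (s.next Letter.a true).Good := by cases s <;> trivial
    simp [hnext, GoodPrefix, selected_append]
  · have hnext : ¬ (s.next Letter.b false).Good := by cases s <;> exact not_false
    simp [hnext, GoodPrefix, selected_append, underlying_append]
  · have hnext : ¬ (s.next Letter.b true).Good := by cases s <;> exact not_false
    simp [hnext, GoodPrefix, selected_append]

/-- The recursion over states becomes a condition at each position, provided `s` summarises the part
`r` already read. -/
theorem isNormalMarking_iff_of_prefix {d : ℕ} {s : NormalState} {r p : List (Letter × Bool)}
    (hlast : s.last = r.getLast?.map Prod.fst) (hgood : s.Good ↔ GoodPrefix r) :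
    IsNormalMarking d s p ↔ ∀ r' x m t, p = r' ++ (x, m) :: t →
      ((r ++ r').getLast?.map Prod.fst = some x → m = true) ∧
        (m = true → StartsWithRun d (x :: selected t) → GoodPrefix (r ++ r')) := by
  induction p generalizing s r with
  | nil => simp [IsNormalMarking]
  | cons e p ih =>
    obtain ⟨y, n⟩ := e
    have hsplit : ∀ P : List (Letter × Bool) → Letter → Bool → List (Letter × Bool) → Prop,
        (∀ r' x m t, (y, n) :: p = r' ++ (x, m) :: t → P r' x m t) ↔
          P [] y n p ∧ ∀ r' x m t, p = r' ++ (x, m) :: t → P ((y, n) :: r') x m t := by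
      intro P
      constructor
      · exact fun h => ⟨h _ _ _ _ rfl, fun r' x m t ht => h _ _ _ _ (by rw [ht]; rfl)⟩
      · rintro ⟨h, h'⟩ (_ | ⟨e, r'⟩) x m t ht
        · simp only [List.nil_append, List.cons.injEq, Prod.mk.injEq] at ht
          obtain ⟨⟨rfl, rfl⟩, rfl⟩ := ht
          exact h
        · obtain ⟨rfl, ht'⟩ := List.cons_eq_cons.1 ht
          exact h' _ _ _ _ ht'
    rw [hsplit, List.append_nil, IsNormalMarking, ← hlast, ← hgood, ← and_assoc]
    -- The rule on repetitions at the current letter must be available before its state can be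
    -- compared with its prefix.
    refine and_congr_right fun h => ?_
    rw [ih (r := r ++ [(y, n)]) ?_ (next_good_iff hlast hgood h.1)]
    · simp only [List.append_assoc, List.singleton_append]
    · rw [List.getLast?_concat]
      cases s <;> cases y <;> cases n <;> rfl

theorem isNormalMarking_start_iff {d : ℕ} {p : List (Letter × Bool)} :
    IsNormalMarking d NormalState.start p ↔ ∀ q (hq : q < p.length),
      ((p.take q).getLast?.map Prod.fst = some p[q].1 → p[q].2 = true) ∧
        (p[q].2 = true → StartsWithRun d (selected (p.drop q)) → GoodPrefix (p.take q)) := by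
  rw [isNormalMarking_iff_of_prefix (r := []) rfl (by simp [NormalState.Good, GoodPrefix])]
  have hdrop : ∀ q (hq : q < p.length), p = p.take q ++ (p[q].1, p[q].2) :: p.drop (q + 1) := by
    intro q hq
    exact ((congrArg (p.take q ++ ·) (List.drop_eq_getElem_cons hq)).symm.trans
      (List.take_append_drop q p)).symm
  constructor
  · intro h q hq
    obtain ⟨h₁, h₂⟩ := h _ _ _ _ (hdrop q hq)
    refine ⟨h₁, fun hm hrun => h₂ hm ?_⟩
    have : p.drop q = (p[q].1, true) :: p.drop (q + 1) := by
      rw [List.drop_eq_getElem_cons hq, ← hm]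
    rwa [this] at hrun
  · rintro h r x m t rfl
    have hq := h r.length (by simp)
    simp only [List.take_left', List.drop_left', List.getElem_append_right, le_refl, Nat.sub_self,
      List.getElem_cons_zero] at hq
    refine ⟨hq.1, fun hm hrun => hq.2 hm ?_⟩
    rw [hm]
    exact hrun

namespace Embedding

variable {u w : List Letter} (i : Embedding u w)

theorem getLast?_take_succ_marking (q : ℕ) (hq : q < w.length) :
    (i.marking.take (q + 1)).getLast? = some (i.marking[q]'(i.length_marking.symm ▸ hq)) := by
  have hq' : q < i.marking.length := i.length_marking.symm ▸ hq
  rw [List.take_succ_eq_append_getElem hq', List.getLast?_concat]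

/-- Before the image of the `j`-th letter, the marked subword is `u.take j`, empty exactly when `j =
0`. Hence the two halves of `GoodPrefix` are the conditions on inner and on initial runs. -/
theorem isNormal_iff (d : ℕ) :
    i.IsNormal d ↔ IsNormalMarking d NormalState.start i.marking := by
  classical
  rw [isNormalMarking_start_iff]
  constructor
  · intro h q hq
    have hqw : q < w.length := i.length_marking ▸ hq
    rw [getElem_marking]
    refine ⟨fun hlast => ?_, fun hm hrun => ?_⟩
    · rw [decide_eq_true_eq]
      rcases q with _ | q
      · simp at hlast
      · rw [getLast?_take_succ_marking _ _ (by omega), Option.map_some, getElem_marking,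
          Option.some_inj] at hlast
        exact h.repetition ⟨q, by omega⟩ ⟨q + 1, hqw⟩ rfl hlast.symm
    · rw [decide_eq_true_eq] at hm
      obtain ⟨j, hj⟩ := hm
      obtain rfl : (i.1 j : ℕ) = q := congrArg Fin.val hj
      rw [selected_drop_marking] at hrun
      rw [GoodPrefix, selected_take_marking]
      refine ⟨fun hne => ?_, fun h0 => ?_⟩
      · have hj0 : 0 < j.1 := by
          rcases Nat.eq_zero_or_pos j.1 with h0 | h0
          · rw [h0] at hne
            exact absurd rfl hne
          · exact h0
        obtain ⟨p, hp, hpa, hpr⟩ := h.inner_run hrun.1 j hj0 hrun.2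
        rw [← hp, getLast?_take_succ_marking _ _ p.2, getElem_marking]
        exact congrArg some (Prod.ext hpa (decide_eq_true hpr))
      · have hj0 : j.1 = 0 := by
          have := congrArg List.length h0
          rw [List.length_take, List.length_nil] at this
          have := j.2
          omega
        have hrun' := hrun.2
        rw [hj0] at hrun'
        intro hb
        rw [underlying, List.map_take] at hb
        rw [← underlying, underlying_marking, List.mem_take_iff_getElem] at hb
        obtain ⟨p, hp, hpb⟩ := hb
        exact h.initial_run hrun.1 j hj0 hrun' ⟨p, by omega⟩
          (Fin.lt_def.2 (by simp only; omega)) hpb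
  · intro h
    have hlen := i.length_marking
    have hpos : ∀ j : Fin u.length, StartsWithRun d (u.drop j) →
        GoodPrefix (i.marking.take (i.1 j)) := fun j hrun => by
      refine (h (i.1 j) (hlen.symm ▸ (i.1 j).2)).2 ?_ ?_
      · rw [getElem_marking]
        exact decide_eq_true ⟨j, rfl⟩
      · rwa [selected_drop_marking]
    refine ⟨fun p q hpq heq => ?_, fun hd j hj hrun => ?_, fun hd j hj hrun p hp hb => ?_⟩
    · have hq := (h q (hlen.symm ▸ q.2)).1
      rw [getElem_marking] at hq
      refine of_decide_eq_true (hq ?_)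
      simp only [hpq]
      rw [getLast?_take_succ_marking _ _ p.2, getElem_marking]
      simp only [Option.map_some, Option.some_inj]
      rw [← List.get_eq_getElem, ← heq]
      simp [hpq]
    · have hg := (hpos j ⟨hd, hrun⟩).1
      rw [selected_take_marking] at hg
      have hne : u.take j ≠ [] := by
        intro h0
        have := congrArg List.length h0
        rw [List.length_take, List.length_nil] at this
        have := j.2
        omega
      have hlast := hg hne
      obtain ⟨q, hq⟩ : ∃ q, (i.1 j : ℕ) = q + 1 := by
        refine Nat.exists_eq_succ_of_ne_zero fun h0 => ?_
        rw [h0] at hlast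
        simp at hlast
      have hqw : q < w.length := by have := (i.1 j).2; omega
      rw [hq, getLast?_take_succ_marking _ _ hqw, getElem_marking, Option.some_inj,
        Prod.mk.injEq, decide_eq_true_eq] at hlast
      exact ⟨⟨q, hqw⟩, hq.symm, hlast.1, hlast.2⟩
    · have hg := (hpos j ⟨hd, by rwa [hj]⟩).2
      rw [selected_take_marking, hj] at hg
      refine hg rfl ?_
      rw [underlying, List.map_take]
      rw [← underlying, underlying_marking, List.mem_take_iff_getElem]
      exact ⟨p, by have := Fin.lt_def.1 hp; have := p.2; omega, hb⟩

end Embedding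

theorem nonempty_markings_equiv_normal (d : ℕ) (u w : List Letter) :
    Nonempty (markings (normalLanguage d NormalState.start) u w ≃
      {i : Embedding u w // i.IsNormal d}) := by
  obtain ⟨φ⟩ := Embedding.nonempty_markings_equiv (normalLanguage d NormalState.start) u w
  exact ⟨φ.trans (Equiv.subtypeEquivRight fun i => (i.isNormal_iff d).symm)⟩

end WordPoset

/-! ### Assembly of the theorem -/

open WordPoset in
theorem theorem4p3 (d : ℕ) :
    (WordPoset.zetaSeries d).IsRational ∧ (WordPoset.muSeries d).IsRational ∧
    (∃ D : WordPoset.Automaton, D.Accepts (WordPoset.zetaSeries d) ∧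
      (∀ W : D.Walk, WordPoset.InAd d (D.walkLeft W) ∧ WordPoset.InAd d (D.walkRight W) ∧
        D.walkCoeff W = 1) ∧
      ∀ u w : WordPoset.Word d, Nonempty (D.WalkOn u.letters w.letters ≃
        {i : WordPoset.Embedding u.letters w.letters // i.IsRightmost})) ∧
    (∃ D : WordPoset.Automaton, D.Accepts (WordPoset.muSeries d) ∧
      (∀ W : D.Walk, WordPoset.InAd d (D.walkLeft W) ∧ WordPoset.InAd d (D.walkRight W) ∧
        D.walkCoeff W = (-1) ^ ((D.walkLeft W).length + (D.walkRight W).length)) ∧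
      ∀ u w : WordPoset.Word d, Nonempty (D.WalkOn u.letters w.letters ≃
        {i : WordPoset.Embedding u.letters w.letters // i.IsNormal d})) := by
  have hζ := isRegular_restrict d (isRegular_rightmostLanguage none)
  have hμ := isRegular_restrict d (isRegular_normalLanguage d NormalState.start)
  rw [zetaSeries_eq, muSeries_eq]
  refine ⟨isRational_countSeries (by norm_num) hζ, isRational_countSeries (by norm_num) hμ, ?_, ?_⟩
  · obtain ⟨D, hacc, hwalk, hequiv⟩ := exists_automaton (c := 1) (by norm_num) hζ
    refine ⟨D, hacc, fun W => ?_, fun u w => ?_⟩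
    · obtain ⟨⟨p, hp, hl, hr⟩, hc⟩ := hwalk W
      rw [hl, hr]
      exact ⟨(mem_restrict.1 hp).2.1, (mem_restrict.1 hp).2.2, by rw [hc, one_pow]⟩
    · obtain ⟨φ⟩ := hequiv u.letters w.letters
      rw [markings_restrict _ u.mem w.mem] at φ
      obtain ⟨ψ⟩ := nonempty_markings_equiv_rightmost u.letters w.letters
      exact ⟨φ.trans ψ⟩
  · obtain ⟨D, hacc, hwalk, hequiv⟩ := exists_automaton (c := -1) (by norm_num) hμ
    refine ⟨D, hacc, fun W => ?_, fun u w => ?_⟩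
    · obtain ⟨⟨p, hp, hl, hr⟩, hc⟩ := hwalk W
      refine ⟨?_, ?_, hc⟩
      · rw [hl]
        exact (mem_restrict.1 hp).2.1
      · rw [hr]
        exact (mem_restrict.1 hp).2.2
    · obtain ⟨φ⟩ := hequiv u.letters w.letters
      rw [markings_restrict _ u.mem w.mem] at φ
      obtain ⟨ψ⟩ := nonempty_markings_equiv_normal d u.letters w.letters
      exact ⟨φ.trans ψ⟩
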